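/- Let $F$ be a field of characteristic different from $2$ and $3$, and let $L = L_{\bar 0}\oplus L_{\bar 1}$ be a finite-dimensional non-abelian nilpotent Lie superalgebra over $F$, with $\dim L_{\bar 0}=m$ and $\dim L_{\bar 1}=n$, whose derived subalgebra $[L,L]$ has even part of dimension $r$ and odd part of dimension $s$. For two Lie superalgebras $M$, $N$ acting on each other, the non-abelian tensor product $M\otimes N$ is the Lie superalgebra generated by the symbols $a\otimes b$ ($a\in M$, $b\in N$ homogeneous, $|a\otimes b|=|a|+|b|$), subject to the relations that $\otimes$ is bilinear and $$[a,a']\otimes b = a\otimes {}^{a'}b-(-1)^{|a||a'|}\,a'\otimes {}^{a}b,$$ $$a\otimes[b,b'] = (-1)^{|b'|(|a|+|b|)}\,{}^{b'}a\otimes b-(-1)^{|a||b|}\,{}^{b}a\otimes b',$$ $$[a\otimes b,a'\otimes b'] = -(-1)^{|a||b|}\,{}^{b}a\otimes {}^{a'}b'.$$ Let $L\otimes L$ be formed with the action of $L$ on itself by the bracket, and let $\otimes^3L=(L\otimes L)\otimes L$, where $L$ acts on $L\otimes L$ by ${}^{l}(a\otimes b)=[l,a]\otimes b+(-1)^{|l||a|}a\otimes[l,b]$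 and $L\otimes L$ acts on $L$ by ${}^{a\otimes b}l=[[a,b],l]$. Then $\otimes^3L$ is finite-dimensional, and its total dimension (the sum of the dimensions of its even and odd parts) satisfies $$\dim\otimes^3L\;\le\;(m+n)\bigl(m+n-(r+s)\bigr)^2 .$$ Moreover, if $r=1$ and $s=0$, then equality holds if and only if $L\cong H(1\mid 0)$, the Heisenberg Lie superalgebra with basis $x_1,x_2,z$, all even, whose only nonzero brackets of basis elements are $[x_1,x_2]=z=-[x_2,x_1]$. -/

import Mathlib

namespace SLie

/-- The Koszul sign `(-1)^{ij}` attached to two degrees in `ℤ/2`. -/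
def ksgn (F : Type*) [Field F] (i j : ZMod 2) : F := (-1) ^ (i.val * j.val)

/-- A Lie superalgebra over `F`: a vector space `L = L₀ ⊕ L₁` with an even bilinear bracket
satisfying graded skew-symmetry and the graded Jacobi identity. -/
class LieSuperalgebra (F L : Type*) [Field F] [AddCommGroup L] [Module F L] where
  /-- the even part `gr 0` and the odd part `gr 1` -/
  gr : ZMod 2 → Submodule F L
  isCompl : IsCompl (gr 0) (gr 1)
  /-- the bracket -/
  br : L →ₗ[F] L →ₗ[F] L
  br_mem : ∀ {i j : ZMod 2} {x y : L}, x ∈ gr i → y ∈ gr j → br x y ∈ gr (i + j)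
  br_skew : ∀ {i j : ZMod 2} {x y : L}, x ∈ gr i → y ∈ gr j →
    br x y = -(ksgn F i j • br y x)
  jacobi : ∀ {i j k : ZMod 2} {x y z : L}, x ∈ gr i → y ∈ gr j → z ∈ gr k →
    ksgn F i k • br x (br y z) + ksgn F j i • br y (br z x) + ksgn F k j • br z (br x y) = 0

open LieSuperalgebra

section Basic

variable (F L : Type*) [Field F] [AddCommGroup L] [Module F L] [LieSuperalgebra F L]

/-- `L` is abelian if its bracket vanishes. -/
def IsAbelian : Prop := ∀ x y : L, br (F := F) x y = 0

/-- The descending central series, indexed from `0`: `lcs 0 = L`, `lcs (k+1) = [lcs k, L]`. -/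
def lcs : ℕ → Submodule F L
  | 0 => ⊤
  | k + 1 => Submodule.map₂ br (lcs k) ⊤

/-- `L` is nilpotent if its descending central series reaches `0`. -/
def IsNilpotent : Prop := ∃ k, lcs F L k = ⊥

/-- The derived subalgebra `[L, L]`. -/
def derived : Submodule F L := Submodule.map₂ br ⊤ ⊤

/-- `SDim U m n` says that the (graded) subspace `U` of `L` is finite-dimensional, with even part
of dimension `m` and odd part of dimension `n`. -/
def SDim {F L : Type*} [Field F] [AddCommGroup L] [Module F L] [LieSuperalgebra F L]
    (U : Submodule F L) (m n : ℕ) : Prop :=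
  Module.Finite F U ∧ Module.finrank F ↥(U ⊓ gr 0) = m ∧ Module.finrank F ↥(U ⊓ gr 1) = n

/-- An isomorphism of Lie superalgebras: a bijective linear map of even degree which preserves
brackets. -/
structure SEquiv (F L L' : Type*) [Field F] [AddCommGroup L] [Module F L] [LieSuperalgebra F L]
    [AddCommGroup L'] [Module F L'] [LieSuperalgebra F L'] extends L ≃ₗ[F] L' where
  map_gr : ∀ (i : ZMod 2) (x : L), x ∈ (gr i : Submodule F L) →
    toLinearEquiv x ∈ (gr i : Submodule F L')
  map_br : ∀ x y : L, toLinearEquiv (br (F := F) x y) =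
    br (F := F) (toLinearEquiv x) (toLinearEquiv y)

end Basic

section Signs

variable {F : Type*} [Field F]

theorem zmod2 (i : ZMod 2) : i = 0 ∨ i = 1 := by revert i; decide

theorem one_one : (1 + 1 : ZMod 2) = 0 := by decide

@[simp] theorem ksgn_zero_left (j : ZMod 2) : ksgn F 0 j = 1 := by simp [ksgn]

@[simp] theorem ksgn_zero_right (j : ZMod 2) : ksgn F j 0 = 1 := by simp [ksgn]

@[simp] theorem ksgn_one_one : ksgn F 1 1 = -1 := by simp [ksgn, ZMod.val_one]

end Signs

section Grading

variable {F L : Type*} [Field F] [AddCommGroup L] [Module F L] [LieSuperalgebra F L]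

variable (F) in
/-- The projection of `L = L₀ ⊕ L₁` onto `Lᵢ`. -/
noncomputable def gproj (i : ZMod 2) : L →ₗ[F] L :=
  if i = 0 then (gr 0).projection (gr 1) isCompl else (gr 1).projection (gr 0) isCompl.symm

theorem gproj_mem (i : ZMod 2) (x : L) : gproj F i x ∈ (gr i : Submodule F L) := by
  rcases zmod2 i with rfl | rfl
  · simp [gproj]
  · simp [gproj]

theorem gproj_add (x : L) : gproj F 0 x + gproj F 1 x = x := by
  simpa [gproj] using Submodule.projection_add_projection_eq_self (isCompl (F := F) (L := L)) x

theorem gproj_of_mem {i j : ZMod 2} {x : L} (hx : x ∈ (gr j : Submodule F L)) :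
    gproj F i x = if j = i then x else 0 := by
  rcases zmod2 i with rfl | rfl <;> rcases zmod2 j with rfl | rfl
  · simpa [gproj] using hx
  · simpa [gproj] using hx
  · simpa [gproj] using hx
  · simpa [gproj] using hx

/-- Linear maps which agree on homogeneous elements are equal. -/
theorem ext_homogeneous {V : Type*} [AddCommGroup V] [Module F V] {f g : L →ₗ[F] V}
    (h : ∀ (i : ZMod 2) (x : L), x ∈ (gr i : Submodule F L) → f x = g x) : f = g := by
  refine LinearMap.ext fun x => ?_
  rw [← gproj_add (F := F) x, map_add, map_add, h 0 _ (gproj_mem 0 x), h 1 _ (gproj_mem 1 x)]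

variable (F) in
/-- The map which multiplies an element of degree `k` by `(-1)^{ki}`. -/
noncomputable def twist (i : ZMod 2) : L →ₗ[F] L :=
  ksgn F 0 i • gproj F 0 + ksgn F 1 i • gproj F 1

theorem twist_of_mem {k : ZMod 2} {x : L} (i : ZMod 2) (hx : x ∈ (gr k : Submodule F L)) :
    twist F i x = ksgn F k i • x := by
  rcases zmod2 k with rfl | rfl <;> simp [twist, gproj_of_mem hx]

end Grading

section Heisenberg

/-- The underlying space of the Heisenberg Lie superalgebra `H(m, n)` with even center. A quadruple
`(p, q, c, y)` stands for `∑ pᵢ xᵢ + ∑ qᵢ x_{m+i} + c z + ∑ yⱼ yⱼ`, where the `xᵢ`, `x_{m+i}` and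
`z` are even and the `yⱼ` are odd. -/
abbrev Heisenberg (F : Type*) (m n : ℕ) : Type _ :=
  (Fin m → F) × (Fin m → F) × F × (Fin n → F)

namespace Heisenberg

variable (F : Type*) [Field F] (m n : ℕ)

/-- The coefficient of `z` in a bracket: `[xᵢ, x_{m+i}] = z = -[x_{m+i}, xᵢ]`, `[yⱼ, yⱼ] = z`. -/
def form (a b : Heisenberg F m n) : F :=
  ∑ i, (a.1 i * b.2.1 i - a.2.1 i * b.1 i) + ∑ j, a.2.2.2 j * b.2.2.2 j

/-- The bracket of `H(m, n)`: every bracket is a multiple of `z`. -/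
def bracket : Heisenberg F m n →ₗ[F] Heisenberg F m n →ₗ[F] Heisenberg F m n :=
  LinearMap.mk₂ F (fun a b => (0, 0, form F m n a b, 0))
    (fun a a' b => by
      simp [form, add_mul, Finset.sum_add_distrib, Finset.sum_sub_distrib]
      ring)
    (fun c a b => by
      simp [form, mul_add, Finset.mul_sum, mul_sub, mul_assoc])
    (fun a b b' => by
      simp [form, mul_add, Finset.sum_add_distrib, Finset.sum_sub_distrib]
      ring)
    (fun c a b => by
      simp [form, mul_add, Finset.mul_sum, mul_sub, mul_left_comm])

/-- The even part `⟨xᵢ, x_{m+i}, z⟩` and the odd part `⟨yⱼ⟩`. -/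
def part (i : ZMod 2) : Submodule F (Heisenberg F m n) where
  carrier := {a | if i = 0 then a.2.2.2 = 0 else a.1 = 0 ∧ a.2.1 = 0 ∧ a.2.2.1 = 0}
  add_mem' := by
    intro a b ha hb
    by_cases h : i = 0 <;> simp_all
  zero_mem' := by by_cases h : i = 0 <;> simp [h]
  smul_mem' := by
    intro c a ha
    by_cases h : i = 0 <;> simp_all

theorem mem_part_zero (a : Heisenberg F m n) : a ∈ part F m n 0 ↔ a.2.2.2 = 0 := by
  simp [part, ← SetLike.mem_coe]

theorem mem_part_one (a : Heisenberg F m n) :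
    a ∈ part F m n 1 ↔ a.1 = 0 ∧ a.2.1 = 0 ∧ a.2.2.1 = 0 := by
  simp [part, ← SetLike.mem_coe]

theorem bracket_apply (a b : Heisenberg F m n) :
    bracket F m n a b = (0, 0, form F m n a b, 0) := rfl

theorem bracket_bracket (a b c : Heisenberg F m n) :
    bracket F m n a (bracket F m n b c) = 0 := by
  simp [bracket_apply, form]

instance : LieSuperalgebra F (Heisenberg F m n) where
  gr := part F m n
  isCompl := by
    constructor
    · rw [Submodule.disjoint_def]
      intro a h0 h1
      rw [mem_part_zero] at h0
      rw [mem_part_one] at h1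
      obtain ⟨h1, h2, h3⟩ := h1
      exact Prod.ext h1 (Prod.ext h2 (Prod.ext h3 h0))
    · rw [codisjoint_iff, eq_top_iff]
      intro a _
      refine Submodule.mem_sup.2 ⟨(a.1, a.2.1, a.2.2.1, 0), ?_, (0, 0, 0, a.2.2.2), ?_, ?_⟩
      · simp [mem_part_zero]
      · simp [mem_part_one]
      · simp
  br := bracket F m n
  br_mem := by
    intro i j x y hx hy
    rcases zmod2 i with rfl | rfl <;> rcases zmod2 j with rfl | rfl <;>
      simp_all [mem_part_zero, mem_part_one, one_one, bracket_apply, form]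
  br_skew := by
    intro i j x y hx hy
    rcases zmod2 i with rfl | rfl <;> rcases zmod2 j with rfl | rfl <;>
      simp_all [mem_part_zero, mem_part_one, bracket_apply, form]
    · congr 1 <;> exact Finset.sum_congr rfl fun i _ => by ring
    · exact Finset.sum_congr rfl fun i _ => by ring
  jacobi := by
    intro i j k x y z _ _ _
    simp only [bracket_bracket, smul_zero, add_zero]

end Heisenberg

end Heisenberg

section Presentation

/-! ### Lie superalgebras presented by homogeneous generators and homogeneous relators -/

variable (F : Type*) [Field F] {X : Type*} (d : X → ZMod 2)

/-- The degree of a nonassociative word in generators of prescribed degrees. -/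
def wordDeg : FreeMagma X → ZMod 2
  | .of x => d x
  | .mul u v => wordDeg u + wordDeg v

variable (X) in
/-- The free nonassociative algebra on `X` (formal linear combinations of words). -/
abbrev FreeNA : Type _ := FreeMagma X →₀ F

/-- The generator of the free nonassociative algebra attached to `x`. -/
noncomputable def FreeNA.gen (x : X) : FreeNA F X := Finsupp.single (.of x) 1

variable (X) in
/-- The product of the free nonassociative algebra: concatenation of words. -/
noncomputable def FreeNA.mul : FreeNA F X →ₗ[F] FreeNA F X →ₗ[F] FreeNA F X :=
  Finsupp.linearCombination F fun u =>
    Finsupp.linearCombination F fun v => Finsupp.single (FreeMagma.mul u v) (1 : F)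

/-- The elements of degree `i` in the free nonassociative algebra. -/
def FreeNA.gr (i : ZMod 2) : Submodule F (FreeNA F X) :=
  Finsupp.supported F F {w | wordDeg d w = i}

/-- Membership in the smallest two-sided ideal of the free nonassociative algebra which contains
the relators `R` and all the relators expressing the axioms of a Lie superalgebra. -/
inductive IdealGen (R : FreeNA F X → Prop) : FreeNA F X → Prop
  | rel {a} : R a → IdealGen R a
  | skew {i j a b} : a ∈ FreeNA.gr F d i → b ∈ FreeNA.gr F d j →
      IdealGen R (FreeNA.mul F X a b + ksgn F i j • FreeNA.mul F X b a)
  | jacobi {i j k a b c} : a ∈ FreeNA.gr F d i → b ∈ FreeNA.gr F d j → c ∈ FreeNA.gr F d k →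
      IdealGen R (ksgn F i k • FreeNA.mul F X a (FreeNA.mul F X b c) +
        ksgn F j i • FreeNA.mul F X b (FreeNA.mul F X c a) +
        ksgn F k j • FreeNA.mul F X c (FreeNA.mul F X a b))
  | zero : IdealGen R 0
  | add {a b} : IdealGen R a → IdealGen R b → IdealGen R (a + b)
  | smul (c : F) {a} : IdealGen R a → IdealGen R (c • a)
  | mul_left (a) {b} : IdealGen R b → IdealGen R (FreeNA.mul F X a b)
  | mul_right {a} (b) : IdealGen R a → IdealGen R (FreeNA.mul F X a b)

/-- The ideal of the previous definition, as a subspace. -/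
def idealGen (R : FreeNA F X → Prop) : Submodule F (FreeNA F X) where
  carrier := {a | IdealGen F d R a}
  add_mem' := .add
  zero_mem' := .zero
  smul_mem' := fun c _ h => .smul c h

/-- The Lie superalgebra presented by generators `X` of degrees `d` and relators `R`. -/
abbrev Presented (R : FreeNA F X → Prop) : Type _ := FreeNA F X ⧸ idealGen F d R

/-- The relators `R` are homogeneous. -/
class HomogeneousRelators (R : FreeNA F X → Prop) : Prop where
  homogeneous : ∀ a, R a → ∃ i, a ∈ FreeNA.gr F d i

variable {F d}

theorem FreeNA.mul_single (u v : FreeMagma X) (a b : F) :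
    FreeNA.mul F X (Finsupp.single u a) (Finsupp.single v b) =
      Finsupp.single (FreeMagma.mul u v) (a * b) := by
  simp [FreeNA.mul, Finsupp.linearCombination_single]

theorem FreeNA.single_mem (w : FreeMagma X) (c : F) :
    Finsupp.single w c ∈ FreeNA.gr F d (wordDeg d w) :=
  Finsupp.single_mem_supported F c rfl

theorem FreeNA.gr_eq_span (i : ZMod 2) : FreeNA.gr F d i =
    Submodule.span F ((fun w => Finsupp.single w (1 : F)) '' {w | wordDeg d w = i}) :=
  Finsupp.supported_eq_span_single F _

theorem FreeNA.gr_induction {i : ZMod 2} {p : FreeNA F X → Prop}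
    (hw : ∀ w, wordDeg d w = i → p (Finsupp.single w 1)) (h0 : p 0)
    (ha : ∀ a b, p a → p b → p (a + b)) (hs : ∀ (c : F) a, p a → p (c • a))
    {a : FreeNA F X} (h : a ∈ FreeNA.gr F d i) : p a := by
  rw [FreeNA.gr_eq_span] at h
  induction h using Submodule.span_induction with
  | mem x hx => obtain ⟨w, hw', rfl⟩ := hx; exact hw w hw'
  | zero => exact h0
  | add x y _ _ hx hy => exact ha _ _ hx hy
  | smul c x _ hx => exact hs _ _ hx

theorem FreeNA.mul_mem {i j : ZMod 2} {a b : FreeNA F X} (ha : a ∈ FreeNA.gr F d i)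
    (hb : b ∈ FreeNA.gr F d j) : FreeNA.mul F X a b ∈ FreeNA.gr F d (i + j) := by
  refine FreeNA.gr_induction (p := fun a => FreeNA.mul F X a b ∈ FreeNA.gr F d (i + j)) ?_ ?_ ?_ ?_ ha
  · intro u hu
    refine FreeNA.gr_induction
      (p := fun b => FreeNA.mul F X _ b ∈ FreeNA.gr F d (i + j)) ?_ ?_ ?_ ?_ hb
    · intro v hv
      rw [FreeNA.mul_single]
      have := FreeNA.single_mem (d := d) (FreeMagma.mul u v) ((1 : F) * 1)
      rwa [wordDeg, hu, hv] at this
    · simp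
    · intro a b h1 h2; rw [map_add]; exact add_mem h1 h2
    · intro c a h; rw [map_smul]; exact Submodule.smul_mem _ _ h
  · simp
  · intro a b h1 h2; rw [map_add, LinearMap.add_apply]; exact add_mem h1 h2
  · intro c a h; rw [map_smul, LinearMap.smul_apply]; exact Submodule.smul_mem _ _ h

variable (F d) in
/-- The projection of the free nonassociative algebra onto its part of degree `i`. -/
noncomputable def FreeNA.proj (i : ZMod 2) : FreeNA F X →ₗ[F] FreeNA F X :=
  Finsupp.linearCombination F fun w => if wordDeg d w = i then Finsupp.single w (1 : F) else 0

theorem FreeNA.proj_single (i : ZMod 2) (w : FreeMagma X) :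
    FreeNA.proj F d i (Finsupp.single w 1) =
      if wordDeg d w = i then Finsupp.single w (1 : F) else 0 := by
  simp [FreeNA.proj]

theorem FreeNA.proj_mem (i : ZMod 2) (a : FreeNA F X) :
    FreeNA.proj F d i a ∈ FreeNA.gr F d i := by
  induction a using Finsupp.induction_linear with
  | zero => simp
  | add a b ha hb => rw [map_add]; exact add_mem ha hb
  | single w c =>
    rw [← mul_one c, ← smul_eq_mul, ← Finsupp.smul_single, map_smul, FreeNA.proj_single]
    refine Submodule.smul_mem _ _ ?_
    split_ifs with h
    · subst h; exact FreeNA.single_mem w 1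
    · exact zero_mem _

theorem FreeNA.proj_of_mem {i j : ZMod 2} {a : FreeNA F X} (ha : a ∈ FreeNA.gr F d j) :
    FreeNA.proj F d i a = if j = i then a else 0 := by
  refine FreeNA.gr_induction
    (p := fun a => FreeNA.proj F d i a = if j = i then a else 0) ?_ ?_ ?_ ?_ ha
  · intro w hw; rw [FreeNA.proj_single, hw]
  · simp
  · intro a b h1 h2; rw [map_add, h1, h2]; split_ifs <;> simp
  · intro c a h; rw [map_smul, h]; split_ifs <;> simp

theorem FreeNA.proj_add (a : FreeNA F X) :
    FreeNA.proj F d 0 a + FreeNA.proj F d 1 a = a := by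
  induction a using Finsupp.induction_linear with
  | zero => simp
  | add a b ha hb =>
    rw [map_add, map_add]
    nth_rewrite 3 [← ha]
    nth_rewrite 3 [← hb]
    abel
  | single w c =>
    rw [← mul_one c, ← smul_eq_mul, ← Finsupp.smul_single, map_smul, map_smul, ← smul_add,
      FreeNA.proj_single, FreeNA.proj_single]
    rcases zmod2 (wordDeg d w) with h | h <;> simp [h]

theorem FreeNA.proj_mul (i : ZMod 2) (a b : FreeNA F X) :
    FreeNA.proj F d i (FreeNA.mul F X a b) =
      FreeNA.mul F X (FreeNA.proj F d 0 a) (FreeNA.proj F d i b) +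
      FreeNA.mul F X (FreeNA.proj F d 1 a) (FreeNA.proj F d (i + 1) b) := by
  have h00 := FreeNA.mul_mem (FreeNA.proj_mem (d := d) 0 a) (FreeNA.proj_mem (d := d) 0 b)
  have h01 := FreeNA.mul_mem (FreeNA.proj_mem (d := d) 0 a) (FreeNA.proj_mem (d := d) 1 b)
  have h10 := FreeNA.mul_mem (FreeNA.proj_mem (d := d) 1 a) (FreeNA.proj_mem (d := d) 0 b)
  have h11 := FreeNA.mul_mem (FreeNA.proj_mem (d := d) 1 a) (FreeNA.proj_mem (d := d) 1 b)
  conv_lhs => rw [← FreeNA.proj_add (d := d) a, ← FreeNA.proj_add (d := d) b]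
  simp only [map_add, LinearMap.add_apply]
  rw [FreeNA.proj_of_mem h00, FreeNA.proj_of_mem h01, FreeNA.proj_of_mem h10,
    FreeNA.proj_of_mem h11]
  rcases zmod2 i with rfl | rfl <;> simp [one_one, add_comm]

theorem FreeNA.isCompl : IsCompl (FreeNA.gr F d 0) (FreeNA.gr F d 1) := by
  constructor
  · rw [Submodule.disjoint_def]
    intro a h0 h1
    have e0 := FreeNA.proj_of_mem (i := 0) h0
    have e1 := FreeNA.proj_of_mem (i := 0) h1
    simp at e0 e1
    exact e0.symm.trans e1
  · rw [codisjoint_iff, eq_top_iff]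
    intro a _
    exact Submodule.mem_sup.2 ⟨_, FreeNA.proj_mem 0 a, _, FreeNA.proj_mem 1 a, FreeNA.proj_add a⟩

/-- The ideal generated by homogeneous relators is a graded subspace. -/
theorem IdealGen.proj {R : FreeNA F X → Prop} [hR : HomogeneousRelators F d R]
    {a : FreeNA F X} (ha : IdealGen F d R a) :
    ∀ i, IdealGen F d R (FreeNA.proj F d i a) := by
  have key : ∀ {a i j}, IdealGen F d R a → a ∈ FreeNA.gr F d j →
      IdealGen F d R (FreeNA.proj F d i a) := by
    intro a i j h h'
    rw [FreeNA.proj_of_mem h']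
    split_ifs
    · exact h
    · exact .zero
  induction ha with
  | rel h =>
    intro i
    obtain ⟨j, hj⟩ := hR.homogeneous _ h
    exact key (.rel h) hj
  | @skew i j a b ha hb =>
    intro k
    refine key (.skew ha hb) (j := i + j) (add_mem (FreeNA.mul_mem ha hb) ?_)
    rw [add_comm i j]
    exact Submodule.smul_mem _ _ (FreeNA.mul_mem hb ha)
  | @jacobi i j k a b c ha hb hc =>
    intro l
    refine key (.jacobi ha hb hc) (j := i + (j + k)) (add_mem (add_mem ?_ ?_) ?_)
    · exact Submodule.smul_mem _ _ (FreeNA.mul_mem ha (FreeNA.mul_mem hb hc))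
    · rw [show i + (j + k) = j + (k + i) by ring]
      exact Submodule.smul_mem _ _ (FreeNA.mul_mem hb (FreeNA.mul_mem hc ha))
    · rw [show i + (j + k) = k + (i + j) by ring]
      exact Submodule.smul_mem _ _ (FreeNA.mul_mem hc (FreeNA.mul_mem ha hb))
  | zero => intro i; rw [map_zero]; exact .zero
  | add _ _ h1 h2 => intro i; rw [map_add]; exact .add (h1 i) (h2 i)
  | smul c _ h => intro i; rw [map_smul]; exact .smul c (h i)
  | mul_left a _ h =>
    intro i; rw [FreeNA.proj_mul]; exact .add (.mul_left _ (h _)) (.mul_left _ (h _))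
  | mul_right b _ h =>
    intro i; rw [FreeNA.proj_mul]; exact .add (.mul_right _ (h _)) (.mul_right _ (h _))

namespace Presented

variable (R : FreeNA F X → Prop)

variable (F d) in
/-- The canonical map from the free nonassociative algebra. -/
noncomputable def mk : FreeNA F X →ₗ[F] Presented F d R := (idealGen F d R).mkQ

theorem mk_eq_zero {a : FreeNA F X} : mk F d R a = 0 ↔ IdealGen F d R a :=
  Submodule.Quotient.mk_eq_zero _

theorem mk_surjective : Function.Surjective (mk F d R) := Submodule.mkQ_surjective _

/-- The bracket of the presented Lie superalgebra, induced by the product of the free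
nonassociative algebra. -/
noncomputable def bracket : Presented F d R →ₗ[F] Presented F d R →ₗ[F] Presented F d R :=
  (idealGen F d R).liftQ
    (LinearMap.flip ((idealGen F d R).liftQ (((FreeNA.mul F X).compr₂ (mk F d R)).flip) (by
      intro b hb
      rw [LinearMap.mem_ker]
      refine LinearMap.ext fun a => ?_
      exact (mk_eq_zero R).2 (.mul_left _ hb))))
    (by
      intro a ha
      rw [LinearMap.mem_ker]
      refine LinearMap.ext fun b => ?_
      obtain ⟨b, rfl⟩ := mk_surjective R b
      exact (mk_eq_zero R).2 (.mul_right _ ha))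

theorem bracket_mk (a b : FreeNA F X) :
    bracket R (mk F d R a) (mk F d R b) = mk F d R (FreeNA.mul F X a b) := rfl

/-- The Lie superalgebra structure of a presented Lie superalgebra. -/
noncomputable instance [HomogeneousRelators F d R] :
    LieSuperalgebra F (Presented F d R) where
  gr i := (FreeNA.gr F d i).map (mk F d R)
  isCompl := by
    constructor
    · rw [Submodule.disjoint_def]
      rintro _ ⟨a, ha, rfl⟩ ⟨b, hb, hab⟩
      rw [← sub_eq_zero, ← map_sub, mk_eq_zero] at hab
      have := hab.proj 0
      rw [map_sub, FreeNA.proj_of_mem ha, FreeNA.proj_of_mem hb] at this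
      simp only [one_ne_zero, if_false, if_true, zero_sub] at this
      rw [mk_eq_zero]
      simpa using this.smul (-1)
    · rw [codisjoint_iff, ← Submodule.map_sup, FreeNA.isCompl.sup_eq_top, Submodule.map_top,
        LinearMap.range_eq_top]
      exact mk_surjective R
  br := bracket R
  br_mem := by
    rintro i j _ _ ⟨a, ha, rfl⟩ ⟨b, hb, rfl⟩
    exact ⟨_, FreeNA.mul_mem ha hb, rfl⟩
  br_skew := by
    rintro i j _ _ ⟨a, ha, rfl⟩ ⟨b, hb, rfl⟩
    rw [bracket_mk, bracket_mk, ← sub_eq_zero, sub_neg_eq_add, ← map_smul, ← map_add, mk_eq_zero]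
    exact .skew ha hb
  jacobi := by
    rintro i j k _ _ _ ⟨a, ha, rfl⟩ ⟨b, hb, rfl⟩ ⟨c, hc, rfl⟩
    exact (mk_eq_zero R).2 (.jacobi ha hb hc)

theorem br_mk [HomogeneousRelators F d R] (a b : FreeNA F X) :
    br (F := F) (mk F d R a) (mk F d R b) = mk F d R (FreeNA.mul F X a b) := rfl

theorem mk_mem [HomogeneousRelators F d R] {i : ZMod 2} {a : FreeNA F X}
    (ha : a ∈ FreeNA.gr F d i) :
    mk F d R a ∈ (gr i : Submodule F (Presented F d R)) := ⟨a, ha, rfl⟩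

section Lift

variable {Q : Type*} [AddCommGroup Q] [Module F Q] [LieSuperalgebra F Q] (f : X → Q)

variable (F) in
/-- Evaluation of a word in a Lie superalgebra. -/
def evalWord : FreeMagma X → Q
  | .of x => f x
  | .mul u v => br (F := F) (evalWord u) (evalWord v)

variable (F) in
/-- Evaluation of an element of the free nonassociative algebra in a Lie superalgebra. -/
noncomputable def eval : FreeNA F X →ₗ[F] Q := Finsupp.linearCombination F (evalWord F f)

theorem eval_gen (x : X) : eval F f (FreeNA.gen F x) = f x := by
  simp [eval, FreeNA.gen, evalWord]

theorem eval_mul (a b : FreeNA F X) :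
    eval F f (FreeNA.mul F X a b) = br (F := F) (eval F f a) (eval F f b) := by
  have : (FreeNA.mul F X).compr₂ (eval F f) = (br (F := F)).compl₁₂ (eval F f) (eval F f) := by
    refine Finsupp.lhom_ext' fun u => LinearMap.ext_ring (Finsupp.lhom_ext' fun v =>
      LinearMap.ext_ring ?_)
    simp [FreeNA.mul_single, eval, evalWord]
  exact LinearMap.congr_fun₂ this a b

theorem eval_mem (hf : ∀ x, f x ∈ (gr (d x) : Submodule F Q)) {i : ZMod 2} {a : FreeNA F X} (ha : a ∈ FreeNA.gr F d i) :
    eval F f a ∈ (gr i : Submodule F Q) := by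
  have hw : ∀ w : FreeMagma X, evalWord F f w ∈ (gr (wordDeg d w) : Submodule F Q) := by
    intro w
    induction w with
    | ih1 x => exact hf x
    | ih2 u v hu hv => exact br_mem hu hv
  refine FreeNA.gr_induction (p := fun a => eval F f a ∈ (gr i : Submodule F Q)) ?_ ?_ ?_ ?_ ha
  · rintro w rfl
    simpa [eval] using hw w
  · simp
  · intro a b h1 h2; rw [map_add]; exact add_mem h1 h2
  · intro c a h; rw [map_smul]; exact Submodule.smul_mem _ _ h

variable {R} (hf : ∀ x, f x ∈ (gr (d x) : Submodule F Q)) (hR : ∀ a, R a → eval F f a = 0)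

/-- The homomorphism from a presented Lie superalgebra to `Q` attached to a map of degree zero
from the generators to `Q` which respects the relators. -/
noncomputable def lift : Presented F d R →ₗ[F] Q :=
  (idealGen F d R).liftQ (eval F f) (by
    intro a ha
    rw [LinearMap.mem_ker]
    change IdealGen F d R a at ha
    induction ha with
    | rel h => exact hR _ h
    | skew ha hb =>
      simp only [map_add, map_smul, eval_mul]
      rw [br_skew (eval_mem f hf ha) (eval_mem f hf hb), neg_add_cancel]
    | jacobi ha hb hc =>
      simp only [map_add, map_smul, eval_mul]
      exact LieSuperalgebra.jacobi (eval_mem f hf ha) (eval_mem f hf hb) (eval_mem f hf hc)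
    | zero => exact map_zero _
    | add _ _ h1 h2 => rw [map_add, h1, h2, add_zero]
    | smul c _ h => rw [map_smul, h, smul_zero]
    | mul_left a _ h => rw [eval_mul, h, map_zero]
    | mul_right b _ h => rw [eval_mul, h, map_zero, LinearMap.zero_apply])

theorem lift_mk (a : FreeNA F X) : lift f hf hR (mk F d R a) = eval F f a := rfl

theorem lift_br [HomogeneousRelators F d R] (s t : Presented F d R) :
    lift f hf hR (br (F := F) s t) = br (F := F) (lift f hf hR s) (lift f hf hR t) := by
  obtain ⟨a, rfl⟩ := mk_surjective R s
  obtain ⟨b, rfl⟩ := mk_surjective R t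
  rw [br_mk, lift_mk, lift_mk, lift_mk, eval_mul]

theorem lift_mem [HomogeneousRelators F d R] {i : ZMod 2} {t : Presented F d R}
    (ht : t ∈ (gr i : Submodule F (Presented F d R))) :
    lift f hf hR t ∈ (gr i : Submodule F Q) := by
  obtain ⟨a, ha, rfl⟩ := ht
  exact eval_mem f hf ha

end Lift

section Derivation

variable [HomogeneousRelators F d R] {L : Type*} [AddCommGroup L] [Module F L]
  [LieSuperalgebra F L] (f : X → L →ₗ[F] Presented F d R)

/-- The value on a word of the superderivation attached to an element of `L` which is given on the
generators by `f`. -/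
noncomputable def derWord : FreeMagma X → L →ₗ[F] Presented F d R
  | .of x => f x
  | .mul u v =>
    (br (F := F)).flip (mk F d R (Finsupp.single v 1)) ∘ₗ derWord u +
      br (F := F) (mk F d R (Finsupp.single u 1)) ∘ₗ derWord v ∘ₗ twist F (wordDeg d u)

/-- The linear extension of `derWord`. -/
noncomputable def derFree : FreeNA F X →ₗ[F] L →ₗ[F] Presented F d R :=
  Finsupp.linearCombination F (derWord R f)

theorem derFree_gen (x : X) : derFree R f (FreeNA.gen F x) = f x := by
  simp [derFree, FreeNA.gen, derWord]

theorem derFree_mul {i k : ZMod 2} {a : FreeNA F X} (ha : a ∈ FreeNA.gr F d i) (b : FreeNA F X)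
    {l : L} (hl : l ∈ (gr k : Submodule F L)) :
    derFree R f (FreeNA.mul F X a b) l =
      br (F := F) (derFree R f a l) (mk F d R b) +
        ksgn F k i • br (F := F) (mk F d R a) (derFree R f b l) := by
  refine FreeNA.gr_induction (p := fun a => derFree R f (FreeNA.mul F X a b) l =
      br (F := F) (derFree R f a l) (mk F d R b) +
        ksgn F k i • br (F := F) (mk F d R a) (derFree R f b l)) ?_ ?_ ?_ ?_ ha
  · rintro u rfl
    induction b using Finsupp.induction_linear with
    | zero => simp
    | add b b' h h' =>
      simp only [map_add, LinearMap.add_apply, h, h', smul_add]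
      abel
    | single v c =>
      rw [← mul_one c, ← smul_eq_mul, ← Finsupp.smul_single]
      simp only [map_smul, LinearMap.smul_apply]
      rw [FreeNA.mul_single, one_mul]
      simp only [derFree, Finsupp.linearCombination_single, one_smul, derWord]
      simp only [LinearMap.add_apply, LinearMap.comp_apply, LinearMap.flip_apply,
        twist_of_mem _ hl, map_smul, smul_add]
      rw [smul_comm c]
  · simp
  · intro a a' h h'
    simp only [map_add, LinearMap.add_apply, h, h', smul_add]
    abel
  · intro c a h
    simp only [map_smul, LinearMap.smul_apply, h, smul_add]
    rw [smul_comm c]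

theorem derFree_mem (hf : ∀ x k l, l ∈ (gr k : Submodule F L) →
      f x l ∈ (gr (k + d x) : Submodule F (Presented F d R))) {i k : ZMod 2} {a : FreeNA F X} (ha : a ∈ FreeNA.gr F d i) {l : L}
    (hl : l ∈ (gr k : Submodule F L)) :
    derFree R f a l ∈ (gr (k + i) : Submodule F (Presented F d R)) := by
  have hw : ∀ w : FreeMagma X, derFree R f (Finsupp.single w 1) l ∈
      (gr (k + wordDeg d w) : Submodule F (Presented F d R)) := by
    intro w
    induction w with
    | ih1 x => simpa [derFree, derWord, wordDeg] using hf x k l hl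
    | ih2 u v hu hv =>
      have := derFree_mul R f (FreeNA.single_mem (d := d) u (1 : F)) (Finsupp.single v 1) hl
      rw [FreeNA.mul_single, one_mul] at this
      change derFree R f (Finsupp.single (FreeMagma.mul u v) 1) l ∈ _
      rw [this]
      refine add_mem ?_ (Submodule.smul_mem _ _ ?_)
      · have := br_mem hu (mk_mem R (FreeNA.single_mem (d := d) v (1 : F)))
        rwa [add_assoc] at this
      · have := br_mem (mk_mem R (FreeNA.single_mem (d := d) u (1 : F))) hv
        rwa [add_left_comm] at this
  refine FreeNA.gr_induction (p := fun a => derFree R f a l ∈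
    (gr (k + i) : Submodule F (Presented F d R))) ?_ ?_ ?_ ?_ ha
  · rintro w rfl
    exact hw w
  · simp
  · intro a b h1 h2; rw [map_add]; exact add_mem h1 h2
  · intro c a h; rw [map_smul]; exact Submodule.smul_mem _ _ h

theorem derFree_ideal (hf : ∀ x k l, l ∈ (gr k : Submodule F L) →
      f x l ∈ (gr (k + d x) : Submodule F (Presented F d R)))
    (hR : ∀ a, R a → ∀ k l, l ∈ (gr k : Submodule F L) → derFree R f a l = 0) {a : FreeNA F X} (ha : IdealGen F d R a) : derFree R f a = 0 := by
  have hm : ∀ {i} {a : FreeNA F X}, a ∈ FreeNA.gr F d i → mk F d R a ∈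
    (gr i : Submodule F (Presented F d R)) := fun h => mk_mem R h
  induction ha with
  | rel h => exact ext_homogeneous (F := F) fun k l hl => hR _ h k l hl
  | @skew i j a b ha hb =>
    refine ext_homogeneous (F := F) fun k l hl => ?_
    simp only [map_add, map_smul, LinearMap.add_apply, LinearMap.smul_apply,
      derFree_mul R f ha b hl, derFree_mul R f hb a hl, LinearMap.zero_apply]
    rw [br_skew (derFree_mem R f hf ha hl) (hm hb), br_skew (derFree_mem R f hf hb hl) (hm ha)]
    rcases zmod2 i with rfl | rfl <;> rcases zmod2 j with rfl | rfl <;>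
      rcases zmod2 k with rfl | rfl <;> simp [one_one]
  | @jacobi i j m a b c ha hb hc =>
    refine ext_homogeneous (F := F) fun k l hl => ?_
    simp only [map_add, map_smul, LinearMap.add_apply, LinearMap.smul_apply,
      derFree_mul R f ha _ hl, derFree_mul R f hb _ hl, derFree_mul R f hc _ hl,
      LinearMap.zero_apply, ← br_mk]
    have h := congrArg₂ (· + ·) (congrArg₂ (· + ·)
      (congrArg (ksgn F k m • ·)
        (LieSuperalgebra.jacobi (derFree_mem R f hf ha hl) (hm hb) (hm hc)))
      (congrArg (ksgn F k i • ·)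
        (LieSuperalgebra.jacobi (hm ha) (derFree_mem R f hf hb hl) (hm hc))))
      (congrArg (ksgn F k j • ·)
        (LieSuperalgebra.jacobi (hm ha) (hm hb) (derFree_mem R f hf hc hl)))
    rcases zmod2 i with rfl | rfl <;> rcases zmod2 j with rfl | rfl <;>
      rcases zmod2 m with rfl | rfl <;> rcases zmod2 k with rfl | rfl <;>
      simp only [one_one, ksgn_zero_left, ksgn_zero_right, ksgn_one_one, zero_add, add_zero,
        one_smul, neg_smul, smul_zero] at h ⊢ <;>
      linear_combination (norm := module) h
  | zero => exact map_zero _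
  | add _ _ h1 h2 => rw [map_add, h1, h2, add_zero]
  | smul c _ h => rw [map_smul, h, smul_zero]
  | mul_left a hb h =>
    refine ext_homogeneous (F := F) fun k l hl => ?_
    rw [← FreeNA.proj_add (d := d) a]
    simp only [map_add, LinearMap.add_apply, derFree_mul R f (FreeNA.proj_mem _ a) _ hl, h,
      (mk_eq_zero R).2 hb, map_zero, LinearMap.zero_apply, smul_zero, add_zero]
  | @mul_right a b ha h =>
    refine ext_homogeneous (F := F) fun k l hl => ?_
    have e : ∀ i, mk F d R (FreeNA.proj F d i a) = 0 := fun i => (mk_eq_zero R).2 (ha.proj i)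
    have h' := LinearMap.congr_fun h l
    rw [← FreeNA.proj_add (d := d) a, map_add, LinearMap.add_apply, LinearMap.zero_apply] at h'
    rw [← FreeNA.proj_add (d := d) a]
    simp only [map_add, LinearMap.add_apply, derFree_mul R f (FreeNA.proj_mem _ a) _ hl, e,
      map_zero, LinearMap.zero_apply, smul_zero, add_zero]
    rw [← LinearMap.add_apply, ← map_add, h', map_zero, LinearMap.zero_apply]

variable (hf : ∀ x k l, l ∈ (gr k : Submodule F L) →
  f x l ∈ (gr (k + d x) : Submodule F (Presented F d R)))
  (hR : ∀ a, R a → ∀ k l, l ∈ (gr k : Submodule F L) → derFree R f a l = 0)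

/-- The linear map from `L` to the superderivations of a presented Lie superalgebra which is given
on the generators by `f`. -/
noncomputable def der : L →ₗ[F] Presented F d R →ₗ[F] Presented F d R :=
  ((idealGen F d R).liftQ (derFree R f) fun _ ha => derFree_ideal R f hf hR ha).flip

theorem der_mk (l : L) (a : FreeNA F X) :
    der R f hf hR l (mk F d R a) = derFree R f a l := rfl

end Derivation

end Presented

end Presentation

section Action

/-- An action of a Lie superalgebra `P` on a Lie superalgebra `M`: an even bilinear map
`(p, m) ↦ ᵖm` such that `P` acts by superderivations and compatibly with the bracket of `P`. -/
structure SuperAction (F P M : Type*) [Field F] [AddCommGroup P] [Module F P]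
    [LieSuperalgebra F P] [AddCommGroup M] [Module F M] [LieSuperalgebra F M] where
  act : P →ₗ[F] M →ₗ[F] M
  act_mem : ∀ {i j : ZMod 2} {p : P} {m : M}, p ∈ (gr i : Submodule F P) →
    m ∈ (gr j : Submodule F M) → act p m ∈ (gr (i + j) : Submodule F M)
  act_br : ∀ {i i' j : ZMod 2} {p p' : P} {m : M}, p ∈ (gr i : Submodule F P) →
    p' ∈ (gr i' : Submodule F P) → m ∈ (gr j : Submodule F M) →
    act (br (F := F) p p') m = act p (act p' m) - ksgn F i i' • act p' (act p m)
  act_der : ∀ {i j j' : ZMod 2} {p : P} {m m' : M}, p ∈ (gr i : Submodule F P) →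
    m ∈ (gr j : Submodule F M) → m' ∈ (gr j' : Submodule F M) →
    act p (br (F := F) m m') =
      br (F := F) (act p m) m' + ksgn F i j • br (F := F) m (act p m')

variable (F L : Type*) [Field F] [AddCommGroup L] [Module F L] [LieSuperalgebra F L]

variable {F L} in
/-- The Jacobi identity, in the form saying that `[x, -]` is a superderivation. -/
theorem br_br {i j k : ZMod 2} {x y z : L} (hx : x ∈ (gr i : Submodule F L))
    (hy : y ∈ (gr j : Submodule F L)) (hz : z ∈ (gr k : Submodule F L)) :
    br (F := F) x (br (F := F) y z) =
      br (F := F) (br (F := F) x y) z + ksgn F i j • br (F := F) y (br (F := F) x z) := by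
  have h := LieSuperalgebra.jacobi hx hy hz
  rw [br_skew hz (br_mem hx hy), br_skew hz hx] at h
  rcases zmod2 i with rfl | rfl <;> rcases zmod2 j with rfl | rfl <;>
    rcases zmod2 k with rfl | rfl <;>
    simp only [one_one, ksgn_zero_left, ksgn_zero_right, ksgn_one_one, zero_add, add_zero,
      one_smul, neg_smul, smul_neg, neg_neg, map_neg] at h ⊢ <;>
    first
    | linear_combination (norm := module) h
    | linear_combination (norm := module) (-1 : F) • h

/-- The action of a Lie superalgebra on itself by the bracket. -/
def adjoint : SuperAction F L L where
  act := br
  act_mem := br_mem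
  act_br hp hp' hm := by rw [br_br hp hp' hm]; abel
  act_der := br_br

theorem adjoint_act : (adjoint F L).act = br := rfl

end Action

section Tensor

variable {F M N : Type*} [Field F] [AddCommGroup M] [Module F M] [LieSuperalgebra F M]
  [AddCommGroup N] [Module F N] [LieSuperalgebra F N]

variable (F M N) in
/-- The symbols `m ⊗ n`, for homogeneous `m` and `n`. -/
structure Sym where
  degLeft : ZMod 2
  degRight : ZMod 2
  left : M
  right : N
  left_mem : left ∈ (gr degLeft : Submodule F M)
  right_mem : right ∈ (gr degRight : Submodule F N)

/-- The degree `|m| + |n|` of the symbol `m ⊗ n`. -/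
def Sym.deg (s : Sym F M N) : ZMod 2 := s.degLeft + s.degRight

/-- The generator `m ⊗ n` of the free nonassociative algebra on the symbols. -/
noncomputable def symGen {i j : ZMod 2} {m : M} {n : N} (hm : m ∈ (gr i : Submodule F M))
    (hn : n ∈ (gr j : Submodule F N)) : FreeNA F (Sym F M N) :=
  FreeNA.gen F ⟨i, j, m, n, hm, hn⟩

variable (α : SuperAction F M N) (β : SuperAction F N M)

/-- The relators which define the non-abelian tensor product of `M` and `N`, where `α` is the
action of `M` on `N` and `β` is the action of `N` on `M`. -/
inductive TensorRel : FreeNA F (Sym F M N) → Prop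
  | smul_left (c : F) {i j m n} (hm : m ∈ (gr i : Submodule F M))
      (hn : n ∈ (gr j : Submodule F N)) :
      TensorRel (c • symGen hm hn - symGen (Submodule.smul_mem _ c hm) hn)
  | smul_right (c : F) {i j m n} (hm : m ∈ (gr i : Submodule F M))
      (hn : n ∈ (gr j : Submodule F N)) :
      TensorRel (c • symGen hm hn - symGen hm (Submodule.smul_mem _ c hn))
  | add_left {i j m m' n} (hm : m ∈ (gr i : Submodule F M)) (hm' : m' ∈ (gr i : Submodule F M))
      (hn : n ∈ (gr j : Submodule F N)) :
      TensorRel (symGen (add_mem hm hm') hn - (symGen hm hn + symGen hm' hn))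
  | add_right {i j m n n'} (hm : m ∈ (gr i : Submodule F M)) (hn : n ∈ (gr j : Submodule F N))
      (hn' : n' ∈ (gr j : Submodule F N)) :
      TensorRel (symGen hm (add_mem hn hn') - (symGen hm hn + symGen hm hn'))
  | br_left {i i' j m m' n} (hm : m ∈ (gr i : Submodule F M)) (hm' : m' ∈ (gr i' : Submodule F M))
      (hn : n ∈ (gr j : Submodule F N)) :
      TensorRel (symGen (br_mem hm hm') hn -
        (symGen hm (α.act_mem hm' hn) - ksgn F i i' • symGen hm' (α.act_mem hm hn)))
  | br_right {i j j' m n n'} (hm : m ∈ (gr i : Submodule F M)) (hn : n ∈ (gr j : Submodule F N))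
      (hn' : n' ∈ (gr j' : Submodule F N)) :
      TensorRel (symGen hm (br_mem hn hn') -
        (ksgn F j' (i + j) • symGen (β.act_mem hn' hm) hn -
          ksgn F i j • symGen (β.act_mem hn hm) hn'))
  | br_br {i j i' j' m n m' n'} (hm : m ∈ (gr i : Submodule F M)) (hn : n ∈ (gr j : Submodule F N))
      (hm' : m' ∈ (gr i' : Submodule F M)) (hn' : n' ∈ (gr j' : Submodule F N)) :
      TensorRel (FreeNA.mul F (Sym F M N) (symGen hm hn) (symGen hm' hn') -
        -(ksgn F i j • symGen (β.act_mem hn hm) (α.act_mem hm' hn')))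

theorem symGen_mem {i j : ZMod 2} {m : M} {n : N} (hm : m ∈ (gr i : Submodule F M))
    (hn : n ∈ (gr j : Submodule F N)) : symGen hm hn ∈ FreeNA.gr F Sym.deg (i + j) :=
  FreeNA.single_mem (d := Sym.deg) (.of ⟨i, j, m, n, hm, hn⟩) (1 : F)

instance : HomogeneousRelators F Sym.deg (TensorRel α β) where
  homogeneous := by
    have e : ∀ {k l : ZMod 2} {a : FreeNA F (Sym F M N)}, a ∈ FreeNA.gr F Sym.deg k → k = l →
      a ∈ FreeNA.gr F Sym.deg l := fun h h' => h' ▸ h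
    intro a ha
    cases ha with
    | smul_left c hm hn =>
      exact ⟨_, sub_mem (Submodule.smul_mem _ _ (symGen_mem hm hn)) (symGen_mem _ hn)⟩
    | smul_right c hm hn =>
      exact ⟨_, sub_mem (Submodule.smul_mem _ _ (symGen_mem hm hn)) (symGen_mem hm _)⟩
    | add_left hm hm' hn =>
      exact ⟨_, sub_mem (symGen_mem _ hn) (add_mem (symGen_mem hm hn) (symGen_mem hm' hn))⟩
    | add_right hm hn hn' =>
      exact ⟨_, sub_mem (symGen_mem hm _) (add_mem (symGen_mem hm hn) (symGen_mem hm hn'))⟩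
    | br_left hm hm' hn =>
      exact ⟨_, sub_mem (symGen_mem _ hn) (sub_mem (e (symGen_mem hm _) (by ring))
        (Submodule.smul_mem _ _ (e (symGen_mem hm' _) (by ring))))⟩
    | br_right hm hn hn' =>
      exact ⟨_, sub_mem (symGen_mem hm _) (sub_mem
        (Submodule.smul_mem _ _ (e (symGen_mem _ hn) (by ring)))
        (Submodule.smul_mem _ _ (e (symGen_mem _ hn') (by ring))))⟩
    | br_br hm hn hm' hn' =>
      exact ⟨_, sub_mem (FreeNA.mul_mem (symGen_mem hm hn) (symGen_mem hm' hn'))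
        (neg_mem (Submodule.smul_mem _ _ (e (symGen_mem _ _) (by ring))))⟩

/-- The non-abelian tensor product `M ⊗ N` of two Lie superalgebras which act on each other:
the Lie superalgebra generated by the symbols `m ⊗ n`, subject to the defining relations. -/
abbrev Tensor : Type _ := Presented F Sym.deg (TensorRel α β)

namespace Tensor

/-- The element `m ⊗ n` for homogeneous `m` and `n`. -/
noncomputable def gen {i j : ZMod 2} {m : M} {n : N} (hm : m ∈ (gr i : Submodule F M))
    (hn : n ∈ (gr j : Submodule F N)) : Tensor α β :=
  Presented.mk F Sym.deg (TensorRel α β) (symGen hm hn)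

theorem eq_of_rel {a b : FreeNA F (Sym F M N)} (h : TensorRel α β (a - b)) :
    Presented.mk F Sym.deg (TensorRel α β) a = Presented.mk F Sym.deg (TensorRel α β) b := by
  rw [← sub_eq_zero, ← map_sub, Presented.mk_eq_zero]
  exact .rel h

theorem gen_mem {i j : ZMod 2} {m : M} {n : N} (hm : m ∈ (gr i : Submodule F M))
    (hn : n ∈ (gr j : Submodule F N)) :
    gen α β hm hn ∈ (gr (i + j) : Submodule F (Tensor α β)) :=
  Presented.mk_mem _ (symGen_mem hm hn)

theorem gen_congr {i j : ZMod 2} {m m' : M} {n n' : N} (hm : m ∈ (gr i : Submodule F M))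
    (hn : n ∈ (gr j : Submodule F N)) (hm' : m' ∈ (gr i : Submodule F M))
    (hn' : n' ∈ (gr j : Submodule F N)) (h : m = m') (h' : n = n') :
    gen α β hm hn = gen α β hm' hn' := by
  subst h h'
  rfl

theorem gen_smul_left (c : F) {i j : ZMod 2} {m : M} {n : N} (hm : m ∈ (gr i : Submodule F M))
    (hn : n ∈ (gr j : Submodule F N)) :
    gen α β (Submodule.smul_mem _ c hm) hn = c • gen α β hm hn :=
  ((eq_of_rel α β (.smul_left c hm hn)).symm.trans (map_smul _ _ _) :)

theorem gen_smul_right (c : F) {i j : ZMod 2} {m : M} {n : N} (hm : m ∈ (gr i : Submodule F M))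
    (hn : n ∈ (gr j : Submodule F N)) :
    gen α β hm (Submodule.smul_mem _ c hn) = c • gen α β hm hn :=
  ((eq_of_rel α β (.smul_right c hm hn)).symm.trans (map_smul _ _ _) :)

theorem gen_add_left {i j : ZMod 2} {m m' : M} {n : N} (hm : m ∈ (gr i : Submodule F M))
    (hm' : m' ∈ (gr i : Submodule F M)) (hn : n ∈ (gr j : Submodule F N)) :
    gen α β (add_mem hm hm') hn = gen α β hm hn + gen α β hm' hn :=
  ((eq_of_rel α β (.add_left hm hm' hn)).trans (map_add _ _ _) :)

theorem gen_add_right {i j : ZMod 2} {m : M} {n n' : N} (hm : m ∈ (gr i : Submodule F M))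
    (hn : n ∈ (gr j : Submodule F N)) (hn' : n' ∈ (gr j : Submodule F N)) :
    gen α β hm (add_mem hn hn') = gen α β hm hn + gen α β hm hn' :=
  ((eq_of_rel α β (.add_right hm hn hn')).trans (map_add _ _ _) :)

theorem gen_zero_left {i j : ZMod 2} {m : M} {n : N} (hm : m ∈ (gr i : Submodule F M))
    (hn : n ∈ (gr j : Submodule F N)) (h : m = 0) : gen α β hm hn = 0 :=
  (gen_congr α β _ _ _ hn (by rw [h, zero_smul]) rfl).trans
    ((gen_smul_left α β 0 hm hn).trans (zero_smul _ _))

theorem gen_zero_right {i j : ZMod 2} {m : M} {n : N} (hm : m ∈ (gr i : Submodule F M))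
    (hn : n ∈ (gr j : Submodule F N)) (h : n = 0) : gen α β hm hn = 0 :=
  (gen_congr α β _ _ hm _ rfl (by rw [h, zero_smul])).trans
    ((gen_smul_right α β 0 hm hn).trans (zero_smul _ _))

/-- The bilinear extension of `gen α β` for fixed degrees. -/
noncomputable def tensAux (i j : ZMod 2) : M →ₗ[F] N →ₗ[F] Tensor α β :=
  LinearMap.mk₂ F (fun m n => gen α β (gproj_mem i m) (gproj_mem j n))
    (fun m m' n => by
      rw [← gen_add_left]; exact gen_congr α β _ _ _ _ (map_add _ _ _) rfl)
    (fun c m n => by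
      rw [← gen_smul_left]; exact gen_congr α β _ _ _ _ (map_smul _ _ _) rfl)
    (fun m n n' => by
      rw [← gen_add_right]; exact gen_congr α β _ _ _ _ rfl (map_add _ _ _))
    (fun c m n => by
      rw [← gen_smul_right]; exact gen_congr α β _ _ _ _ rfl (map_smul _ _ _))

theorem tensAux_of_mem {i j k l : ZMod 2} {m : M} {n : N} (hm : m ∈ (gr i : Submodule F M))
    (hn : n ∈ (gr j : Submodule F N)) :
    tensAux α β k l m n = if i = k ∧ j = l then gen α β hm hn else 0 := by
  change gen α β (gproj_mem k m) (gproj_mem l n) = _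
  by_cases hk : i = k
  · by_cases hl : j = l
    · subst hk hl
      rw [if_pos ⟨rfl, rfl⟩]
      exact gen_congr α β _ _ _ _ ((gproj_of_mem hm).trans (if_pos rfl))
        ((gproj_of_mem hn).trans (if_pos rfl))
    · rw [if_neg (fun h => hl h.2)]
      exact gen_zero_right α β _ _ ((gproj_of_mem hn).trans (if_neg hl))
  · rw [if_neg (fun h => hk h.1)]
    exact gen_zero_left α β _ _ ((gproj_of_mem hm).trans (if_neg hk))

/-- The bilinear map `(m, n) ↦ m ⊗ n`, for arbitrary `m` and `n`. -/
noncomputable def tens : M →ₗ[F] N →ₗ[F] Tensor α β :=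
  tensAux α β 0 0 + tensAux α β 0 1 + tensAux α β 1 0 + tensAux α β 1 1

theorem gen_eq {i j : ZMod 2} {m : M} {n : N} (hm : m ∈ (gr i : Submodule F M))
    (hn : n ∈ (gr j : Submodule F N)) : gen α β hm hn = tens α β m n := by
  simp only [tens, LinearMap.add_apply, tensAux_of_mem α β hm hn]
  rcases zmod2 i with rfl | rfl <;> rcases zmod2 j with rfl | rfl <;> simp

theorem mk_symGen {i j : ZMod 2} {m : M} {n : N} (hm : m ∈ (gr i : Submodule F M))
    (hn : n ∈ (gr j : Submodule F N)) :
    Presented.mk F Sym.deg (TensorRel α β) (symGen hm hn) = tens α β m n := gen_eq α β hm hn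

theorem tens_mem {i j : ZMod 2} {m : M} {n : N} (hm : m ∈ (gr i : Submodule F M))
    (hn : n ∈ (gr j : Submodule F N)) :
    tens α β m n ∈ (gr (i + j) : Submodule F (Tensor α β)) :=
  gen_eq α β hm hn ▸ gen_mem α β hm hn

theorem tens_br_left {i i' j : ZMod 2} {m m' : M} {n : N} (hm : m ∈ (gr i : Submodule F M))
    (hm' : m' ∈ (gr i' : Submodule F M)) (hn : n ∈ (gr j : Submodule F N)) :
    tens α β (br (F := F) m m') n =
      tens α β m (α.act m' n) - ksgn F i i' • tens α β m' (α.act m n) := by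
  have := eq_of_rel α β (.br_left hm hm' hn)
  simpa only [map_sub, map_smul, mk_symGen] using this

theorem tens_br_right {i j j' : ZMod 2} {m : M} {n n' : N} (hm : m ∈ (gr i : Submodule F M))
    (hn : n ∈ (gr j : Submodule F N)) (hn' : n' ∈ (gr j' : Submodule F N)) :
    tens α β m (br (F := F) n n') =
      ksgn F j' (i + j) • tens α β (β.act n' m) n - ksgn F i j • tens α β (β.act n m) n' := by
  have := eq_of_rel α β (.br_right hm hn hn')
  simpa only [map_sub, map_smul, mk_symGen] using this

theorem br_tens {i j i' j' : ZMod 2} {m m' : M} {n n' : N} (hm : m ∈ (gr i : Submodule F M))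
    (hn : n ∈ (gr j : Submodule F N)) (hm' : m' ∈ (gr i' : Submodule F M))
    (hn' : n' ∈ (gr j' : Submodule F N)) :
    br (F := F) (tens α β m n) (tens α β m' n') =
      -(ksgn F i j • tens α β (β.act n m) (α.act m' n')) := by
  have := eq_of_rel α β (.br_br hm hn hm' hn')
  simpa only [map_neg, map_smul, mk_symGen, ← Presented.br_mk] using this

/-- `M ⊗ N` is spanned by the elements `m ⊗ n` with `m` and `n` homogeneous. -/
theorem span_tens : Submodule.span F {t : Tensor α β | ∃ (i j : ZMod 2) (m : M) (n : N),
    m ∈ (gr i : Submodule F M) ∧ n ∈ (gr j : Submodule F N) ∧ tens α β m n = t} = ⊤ := by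
  set U := Submodule.span F {t : Tensor α β | ∃ (i j : ZMod 2) (m : M) (n : N),
    m ∈ (gr i : Submodule F M) ∧ n ∈ (gr j : Submodule F N) ∧ tens α β m n = t} with hU
  have hbr : ∀ s ∈ U, ∀ t ∈ U, br (F := F) s t ∈ U := by
    have h : Submodule.map₂ br U U ≤ U := by
      rw [hU, Submodule.map₂_span_span, Submodule.span_le]
      rintro _ ⟨_, ⟨i, j, m, n, hm, hn, rfl⟩, _, ⟨i', j', m', n', hm', hn', rfl⟩, rfl⟩
      change br (F := F) (tens α β m n) (tens α β m' n') ∈ _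
      rw [br_tens α β hm hn hm' hn']
      exact neg_mem (Submodule.smul_mem _ _ (Submodule.subset_span
        ⟨_, _, _, _, β.act_mem hn hm, α.act_mem hm' hn', rfl⟩))
    exact fun s hs t ht => h (Submodule.apply_mem_map₂ _ hs ht)
  rw [eq_top_iff]
  rintro t -
  obtain ⟨a, rfl⟩ := Presented.mk_surjective _ t
  induction a using Finsupp.induction_linear with
  | zero => simp
  | add a b ha hb => rw [map_add]; exact add_mem ha hb
  | single w c =>
    rw [← mul_one c, ← smul_eq_mul, ← Finsupp.smul_single, map_smul]
    refine Submodule.smul_mem _ _ ?_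
    induction w with
    | ih1 x =>
      exact Submodule.subset_span ⟨_, _, _, _, x.left_mem, x.right_mem,
        (mk_symGen α β x.left_mem x.right_mem).symm⟩
    | ih2 u v hu hv =>
      have := hbr _ hu _ hv
      rwa [Presented.br_mk, FreeNA.mul_single, one_mul] at this

theorem ext_tens {V : Type*} [AddCommGroup V] [Module F V] {f g : Tensor α β →ₗ[F] V}
    (h : ∀ (i j : ZMod 2) (m : M) (n : N), m ∈ (gr i : Submodule F M) →
      n ∈ (gr j : Submodule F N) → f (tens α β m n) = g (tens α β m n)) : f = g := by
  refine LinearMap.ext_on (span_tens α β) ?_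
  rintro _ ⟨i, j, m, n, hm, hn, rfl⟩
  exact h i j m n hm hn

end Tensor

end Tensor

section Square

/-! ### The tensor square and the triple tensor product -/

variable (F L : Type*) [Field F] [AddCommGroup L] [Module F L] [LieSuperalgebra F L]

/-- The tensor square `L ⊗ L`, where `L` acts on itself by the bracket. -/
abbrev Square : Type _ := Tensor (adjoint F L) (adjoint F L)

namespace Square

/-- The bilinear map `(a, b) ↦ a ⊗ b`. -/
noncomputable abbrev tens : L →ₗ[F] L →ₗ[F] Square F L :=
  Tensor.tens (adjoint F L) (adjoint F L)

/-- The homomorphism `λ : L ⊗ L → L`, `a ⊗ b ↦ [a, b]`. -/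
noncomputable def lam : Square F L →ₗ[F] L :=
  Presented.lift (fun s : Sym F L L => br (F := F) s.left s.right)
    (fun s => br_mem s.left_mem s.right_mem) (by
      have e : ∀ {i j : ZMod 2} {m n : L} (hm : m ∈ (gr i : Submodule F L))
          (hn : n ∈ (gr j : Submodule F L)),
          Presented.eval F (fun s : Sym F L L => br (F := F) s.left s.right) (symGen hm hn) =
            br (F := F) m n := fun hm hn => Presented.eval_gen _ _
      intro a ha
      cases ha with
      | smul_left c hm hn => simp [e]
      | smul_right c hm hn => simp [e]
      | add_left hm hm' hn => simp [e]
      | add_right hm hn hn' => simp [e]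
      | br_left hm hm' hn =>
        simp only [map_sub, map_smul, e, adjoint_act]
        rw [br_br hm hm' hn]
        abel
      | @br_right i j k m n n' hm hn hn' =>
        simp only [map_sub, map_smul, e, adjoint_act]
        rw [br_br hm hn hn', br_skew (br_mem hn' hm) hn, br_skew hn' hm, br_skew hn hm]
        rcases zmod2 i with rfl | rfl <;> rcases zmod2 j with rfl | rfl <;>
          rcases zmod2 k with rfl | rfl <;> simp [one_one] <;> abel
      | br_br hm hn hm' hn' =>
        simp only [map_sub, map_neg, map_smul, Presented.eval_mul, e, adjoint_act]
        rw [br_skew hm hn]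
        simp)

theorem lam_tens (a b : L) : lam F L (tens F L a b) = br (F := F) a b := by
  have : (tens F L).compr₂ (lam F L) = br := by
    refine ext_homogeneous (F := F) fun i a ha => ext_homogeneous (F := F) fun j b hb => ?_
    change lam F L (Tensor.tens _ _ a b) = _
    rw [← Tensor.mk_symGen _ _ ha hb]
    exact Presented.eval_gen _ _
  exact LinearMap.congr_fun₂ this a b

theorem lam_br (s t : Square F L) :
    lam F L (br (F := F) s t) = br (F := F) (lam F L s) (lam F L t) :=
  Presented.lift_br _ _ _ s t

theorem lam_mem {i : ZMod 2} {t : Square F L} (ht : t ∈ (gr i : Submodule F (Square F L))) :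
    lam F L t ∈ (gr i : Submodule F L) :=
  Presented.lift_mem _ _ _ ht

/-- The action of `L ⊗ L` on `L`: an element `t` acts as the bracket with `λ(t)`. -/
noncomputable def actOnBase : SuperAction F (Square F L) L where
  act := br (F := F) ∘ₗ lam F L
  act_mem hp hm := br_mem (lam_mem F L hp) hm
  act_br {i i' j p p' m} hp hp' hm := by
    simp only [LinearMap.comp_apply, lam_br]
    exact (adjoint F L).act_br (lam_mem F L hp) (lam_mem F L hp') hm
  act_der hp hm hm' := (adjoint F L).act_der (lam_mem F L hp) hm hm'

/-- The superderivation attached to `l` on the generator `a ⊗ b`, namely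
`[l, a] ⊗ b + (-1)^{|l||a|} a ⊗ [l, b]`. -/
noncomputable def genAct (s : Sym F L L) : L →ₗ[F] Square F L :=
  (tens F L).flip s.right ∘ₗ br (F := F).flip s.left +
    tens F L s.left ∘ₗ br (F := F).flip s.right ∘ₗ twist F s.degLeft

variable {F L}

theorem genAct_apply (s : Sym F L L) {k : ZMod 2} {l : L} (hl : l ∈ (gr k : Submodule F L)) :
    genAct F L s l = tens F L (br (F := F) l s.left) s.right +
      ksgn F k s.degLeft • tens F L s.left (br (F := F) l s.right) := by
  simp [genAct, twist_of_mem _ hl]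

theorem genAct_mem (s : Sym F L L) (k : ZMod 2) (l : L) (hl : l ∈ (gr k : Submodule F L)) :
    genAct F L s l ∈ (gr (k + s.deg) : Submodule F (Square F L)) := by
  rw [genAct_apply s hl, Sym.deg]
  refine add_mem ?_ (Submodule.smul_mem _ _ ?_)
  · rw [← add_assoc]
    exact Tensor.tens_mem _ _ (br_mem hl s.left_mem) s.right_mem
  · rw [add_left_comm]
    exact Tensor.tens_mem _ _ s.left_mem (br_mem hl s.right_mem)

theorem tens_br_left {i i' j : ZMod 2} {m m' n : L} (hm : m ∈ (gr i : Submodule F L))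
    (hm' : m' ∈ (gr i' : Submodule F L)) (hn : n ∈ (gr j : Submodule F L)) :
    tens F L (br (F := F) m m') n = tens F L m (br (F := F) m' n) -
      ksgn F i i' • tens F L m' (br (F := F) m n) :=
  Tensor.tens_br_left _ _ hm hm' hn

theorem tens_br_right {i j j' : ZMod 2} {m n n' : L} (hm : m ∈ (gr i : Submodule F L))
    (hn : n ∈ (gr j : Submodule F L)) (hn' : n' ∈ (gr j' : Submodule F L)) :
    tens F L m (br (F := F) n n') = ksgn F j' (i + j) • tens F L (br (F := F) n' m) n -
      ksgn F i j • tens F L (br (F := F) n m) n' :=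
  Tensor.tens_br_right _ _ hm hn hn'

theorem br_tens {i j i' j' : ZMod 2} {m m' n n' : L} (hm : m ∈ (gr i : Submodule F L))
    (hn : n ∈ (gr j : Submodule F L)) (hm' : m' ∈ (gr i' : Submodule F L))
    (hn' : n' ∈ (gr j' : Submodule F L)) :
    br (F := F) (tens F L m n) (tens F L m' n') =
      -(ksgn F i j • tens F L (br (F := F) n m) (br (F := F) m' n')) :=
  Tensor.br_tens _ _ hm hn hm' hn'

theorem genAct_rel (a : FreeNA F (Sym F L L))
    (ha : TensorRel (adjoint F L) (adjoint F L) a) (k : ZMod 2) (l : L)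
    (hl : l ∈ (gr k : Submodule F L)) :
    Presented.derFree (TensorRel (adjoint F L) (adjoint F L)) (genAct F L) a l = 0 := by
  have e : ∀ {i j : ZMod 2} {m n : L} (hm : m ∈ (gr i : Submodule F L))
      (hn : n ∈ (gr j : Submodule F L)),
      Presented.derFree (TensorRel (adjoint F L) (adjoint F L)) (genAct F L) (symGen hm hn) l =
        tens F L (br (F := F) l m) n + ksgn F k i • tens F L m (br (F := F) l n) :=
    fun hm hn => by
      rw [symGen, Presented.derFree_gen, genAct_apply _ hl]
  cases ha with
  | smul_left c hm hn => simp [e]; module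
  | smul_right c hm hn => simp [e]; module
  | add_left hm hm' hn => simp [e]; abel
  | add_right hm hn hn' => simp [e]; abel
  | @br_left i i' j m m' n hm hm' hn =>
    simp only [map_sub, map_smul, LinearMap.sub_apply, LinearMap.smul_apply, e]
    simp only [adjoint_act]
    rw [br_br hl hm hm', map_add, map_smul, LinearMap.add_apply, LinearMap.smul_apply,
      tens_br_left (br_mem hl hm) hm' hn, tens_br_left hm (br_mem hl hm') hn,
      tens_br_left hm hm' (br_mem hl hn), br_br hl hm' hn, br_br hl hm hn]
    simp only [map_add, map_smul]
    rcases zmod2 i with rfl | rfl <;> rcases zmod2 i' with rfl | rfl <;>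
      rcases zmod2 k with rfl | rfl <;>
      simp only [one_one, ksgn_zero_left, ksgn_zero_right, ksgn_one_one, zero_add, add_zero] <;>
      module
  | @br_right i j j' m n n' hm hn hn' =>
    simp only [map_sub, map_smul, LinearMap.sub_apply, LinearMap.smul_apply, e]
    simp only [adjoint_act]
    rw [br_br hl hn hn', map_add, map_smul, tens_br_right (br_mem hl hm) hn hn',
      tens_br_right hm (br_mem hl hn) hn', tens_br_right hm hn (br_mem hl hn'),
      br_br hl hn' hm, br_br hl hn hm]
    simp only [map_add, map_smul, LinearMap.add_apply, LinearMap.smul_apply]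
    rcases zmod2 i with rfl | rfl <;> rcases zmod2 j with rfl | rfl <;>
      rcases zmod2 j' with rfl | rfl <;> rcases zmod2 k with rfl | rfl <;>
      simp only [one_one, ksgn_zero_left, ksgn_zero_right, ksgn_one_one, zero_add, add_zero] <;>
      module
  | @br_br i j i' j' m n m' n' hm hn hm' hn' =>
    simp only [map_sub, map_neg, map_smul, LinearMap.sub_apply, LinearMap.neg_apply,
      LinearMap.smul_apply, Presented.derFree_mul _ _ (symGen_mem hm hn) _ hl, e,
      Tensor.mk_symGen]
    simp only [adjoint_act]
    change br (F := F) (_ + ksgn F k i • _) (tens F L m' n') +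
      ksgn F k (i + j) • br (F := F) (tens F L m n) (_ + ksgn F k i' • _) - _ = _
    simp only [map_add, map_smul, LinearMap.add_apply, LinearMap.smul_apply]
    rw [br_tens (br_mem hl hm) hn hm' hn', br_tens hm (br_mem hl hn) hm' hn',
      br_tens hm hn (br_mem hl hm') hn', br_tens hm hn hm' (br_mem hl hn'),
      SLie.br_br hl hn hm, SLie.br_br hl hm' hn', br_skew hn (br_mem hl hm),
      br_skew (br_mem hl hn) hm]
    simp only [map_add, map_neg, map_smul, LinearMap.add_apply, LinearMap.neg_apply,
      LinearMap.smul_apply]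
    rcases zmod2 i with rfl | rfl <;> rcases zmod2 j with rfl | rfl <;>
      rcases zmod2 i' with rfl | rfl <;> rcases zmod2 k with rfl | rfl <;>
      simp only [one_one, ksgn_zero_left, ksgn_zero_right, ksgn_one_one, zero_add, add_zero] <;>
      module

variable (F L)

/-- The bilinear map `(l, t) ↦ ˡt` underlying the action of `L` on `L ⊗ L`. -/
noncomputable def act : L →ₗ[F] Square F L →ₗ[F] Square F L :=
  Presented.der (TensorRel (adjoint F L) (adjoint F L)) (genAct F L) genAct_mem genAct_rel

variable {F L}

/-- The formula which characterizes the action of `L` on `L ⊗ L`. -/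
theorem act_tens {k i j : ZMod 2} {l a b : L} (hl : l ∈ (gr k : Submodule F L))
    (ha : a ∈ (gr i : Submodule F L)) (hb : b ∈ (gr j : Submodule F L)) :
    act F L l (tens F L a b) =
      tens F L (br (F := F) l a) b + ksgn F k i • tens F L a (br (F := F) l b) := by
  change act F L l (Tensor.tens _ _ a b) = _
  rw [← Tensor.mk_symGen _ _ ha hb]
  refine (Presented.der_mk _ _ _ _ _ _).trans ?_
  rw [symGen, Presented.derFree_gen, genAct_apply _ hl]

variable (F L)

/-- The action of `L` on `L ⊗ L`. -/
noncomputable def actOnSquare : SuperAction F L (Square F L) where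
  act := act F L
  act_mem {i j p t} hp ht := by
    obtain ⟨a, ha, rfl⟩ := ht
    exact Presented.derFree_mem _ _ genAct_mem ha hp
  act_br {i i' j p p' t} hp hp' _ := by
    have : act F L (br (F := F) p p') =
        act F L p ∘ₗ act F L p' - ksgn F i i' • act F L p' ∘ₗ act F L p := by
      refine Tensor.ext_tens _ _ fun k l m n hm hn => ?_
      simp only [LinearMap.sub_apply, LinearMap.smul_apply, LinearMap.comp_apply]
      rw [act_tens (br_mem hp hp') hm hn, act_tens hp hm hn, act_tens hp' hm hn]
      simp only [map_add, map_smul]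
      rw [act_tens hp (br_mem hp' hm) hn, act_tens hp hm (br_mem hp' hn),
        act_tens hp' (br_mem hp hm) hn, act_tens hp' hm (br_mem hp hn),
        br_br hp hp' hm, br_br hp hp' hn]
      simp only [map_add, map_smul, LinearMap.add_apply, LinearMap.smul_apply]
      rcases zmod2 i with rfl | rfl <;> rcases zmod2 i' with rfl | rfl <;>
        rcases zmod2 k with rfl | rfl <;>
        simp only [one_one, ksgn_zero_left, ksgn_zero_right, ksgn_one_one, zero_add, add_zero] <;>
        module
    exact LinearMap.congr_fun this t
  act_der {i j j' p t t'} hp ht ht' := by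
    obtain ⟨a, ha, rfl⟩ := ht
    obtain ⟨b, hb, rfl⟩ := ht'
    exact Presented.derFree_mul _ _ ha b hp

end Square

/-- The triple tensor product `⊗³L = (L ⊗ L) ⊗ L`. -/
abbrev TripleTensor : Type _ := Tensor (Square.actOnBase F L) (Square.actOnSquare F L)

end Square

end SLie

/-! The upper bound comes from one spanning statement. Choose a graded subspace `W` with `W + [L, L]
= L`. The defining relation for `m ⊗ [n, n']` rewrites it through elements whose right factor is `n`
or `n'`. Hence the right factors can be pushed into any generating subspace, and by nilpotency `W`
generates `L` (`eq_top_of_sup_derived_eq_top`). So `M ⊗ L` is a quotient of the vector space `M ⊗_F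
W` (`Tensor.ofTensorProduct_surjective`), and `dim (M ⊗ L) ≤ dim M * dim W`. Nothing is asked of `M`
beyond finite dimension, so the estimate applies with `M = L` and then with `M = L ⊗ L`; the factor
`dim W ≤ m + n - (r + s)` enters twice.

Let `r = 1`, `s = 0`. Then `[L, L]` is a central even line spanned by some `z`. Equality forces `L
⊗_F W → L ⊗ L` to be injective, so `z ⊗ w ≠ 0` for nonzero `w` in `W`; since `z ⊗ z = 0`, the
elements `x` with `z ⊗ x = 0` lie in `[L, L]`. If `z = [a, b]` with `a`, `b` even, then `z ⊗ w = a ⊗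
[b, w] - b ⊗ [a, w]`, which is zero whenever `w` commutes with `a` and `b`. Odd elements do so,
hence there are none besides zero; every even element does so after subtracting a combination of `a`
and `b`, hence `L` is spanned by `a`, `b`, `z`. If there is no such pair, then `[y, y] ≠ 0` for some
odd `y`, and the relations give `3 • ([y, y] ⊗ y) = 0`, which would put the odd element `y` in the
even line `[L, L]`.

Conversely, for `H(1 ∣ 0)` the bounds are `6` for the square and `12` for the triple product.
Explicit bilinear maps satisfying the tensor relations (`six_le_finrank_square`,
`two_mul_finrank_square_le`) show that they are attained. -/

namespace SLie

open LieSuperalgebra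
open scoped TensorProduct

/-! ### Generation of a nilpotent Lie superalgebra modulo its derived subalgebra -/

section Generation

variable {F L : Type*} [Field F] [AddCommGroup L] [Module F L] [LieSuperalgebra F L]

theorem br_mem_derived (x y : L) : br (F := F) x y ∈ derived F L :=
  Submodule.apply_mem_map₂ _ trivial trivial

theorem gproj_br (i : ZMod 2) (x y : L) :
    gproj F i (br (F := F) x y) = br (F := F) (gproj F 0 x) (gproj F i y) +
      br (F := F) (gproj F 1 x) (gproj F (i + 1) y) := by
  have h (j k : ZMod 2) := br_mem (gproj_mem (F := F) j x) (gproj_mem (F := F) k y)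
  conv_lhs => rw [← gproj_add (F := F) x, ← gproj_add (F := F) y]
  simp only [map_add, LinearMap.add_apply]
  rw [gproj_of_mem (h 0 0), gproj_of_mem (h 0 1), gproj_of_mem (h 1 0), gproj_of_mem (h 1 1)]
  rcases zmod2 i with rfl | rfl <;> simp [one_one, add_comm]

/-- Skew-symmetry is available only for homogeneous elements, so the terms of the series must be
known to be graded before brackets can be swapped in them. -/
theorem gproj_mem_lcs (k : ℕ) : ∀ (i : ZMod 2), ∀ x ∈ lcs F L k, gproj F i x ∈ lcs F L k := by
  induction k with
  | zero => exact fun _ _ _ => Submodule.mem_top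
  | succ k ih =>
    intro i x hx
    have : lcs F L (k + 1) ≤ (lcs F L (k + 1)).comap (gproj F i) :=
      Submodule.map₂_le.2 fun u hu v _ => by
        rw [Submodule.mem_comap, gproj_br]
        exact add_mem (Submodule.apply_mem_map₂ _ (ih 0 _ hu) trivial)
          (Submodule.apply_mem_map₂ _ (ih 1 _ hu) trivial)
    exact this hx

/-- The series is defined with its terms in the left slot of the bracket; graded skew-symmetry,
component by component, moves them to the right slot. -/
theorem br_mem_lcs {k : ℕ} (x : L) {u : L} (hu : u ∈ lcs F L k) :
    br (F := F) x u ∈ lcs F L (k + 1) := by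
  rw [← gproj_add (F := F) x, ← gproj_add (F := F) u]
  have h (i j : ZMod 2) : br (F := F) (gproj F i x) (gproj F j u) ∈ lcs F L (k + 1) := by
    rw [br_skew (gproj_mem i x) (gproj_mem j u)]
    exact neg_mem (Submodule.smul_mem _ _
      (Submodule.apply_mem_map₂ _ (gproj_mem_lcs k j u hu) trivial))
  simp only [map_add, LinearMap.add_apply]
  exact add_mem (add_mem (h 0 0) (h 1 0)) (add_mem (h 0 1) (h 1 1))

/-- A subalgebra of a nilpotent Lie superalgebra which covers the abelianization is everything. -/
theorem eq_top_of_sup_derived_eq_top (hnil : IsNilpotent F L) {C : Submodule F L}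
    (hC : C ⊔ derived F L = ⊤) (hbr : ∀ x ∈ C, ∀ y ∈ C, br (F := F) x y ∈ C) : C = ⊤ := by
  -- Since `lcs 1` is the derived subalgebra, the case `k = 0` is trivial. For the step, write both
  -- arguments of a bracket as an element of `C` plus one of `lcs (k + 1)`: only `[c, c']` escapes
  -- `lcs (k + 2)`, and it lies in `C`.
  have h : ∀ k, derived F L ≤ C ⊔ lcs F L (k + 1) := by
    intro k
    induction k with
    | zero => exact le_sup_right
    | succ k ih =>
      have hk : C ⊔ lcs F L (k + 1) = ⊤ :=
        top_le_iff.1 (hC ▸ sup_le le_sup_left ih)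
      refine Submodule.map₂_le.2 fun x _ y _ => ?_
      obtain ⟨c, hc, u, hu, rfl⟩ := Submodule.mem_sup.1 (hk.ge (Submodule.mem_top (x := x)))
      obtain ⟨c', hc', v, hv, rfl⟩ := Submodule.mem_sup.1 (hk.ge (Submodule.mem_top (x := y)))
      have e : br (F := F) (c + u) (c' + v) =
          br (F := F) c c' + (br (F := F) c v + br (F := F) u (c' + v)) := by
        simp only [map_add, LinearMap.add_apply]
        abel
      rw [e]
      exact Submodule.add_mem_sup (hbr _ hc _ hc')
        (add_mem (br_mem_lcs _ hv) (Submodule.apply_mem_map₂ _ hu trivial))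
  obtain ⟨k, hk⟩ := hnil
  have h0 : lcs F L (k + 1) = ⊥ := by
    change Submodule.map₂ br (lcs F L k) ⊤ = ⊥
    rw [hk, Submodule.map₂_bot_left]
  rw [eq_top_iff, ← hC]
  exact sup_le le_rfl ((h k).trans (by rw [h0, sup_bot_eq]))

theorem finrank_eq_of_sDim_top {m n : ℕ} (hL : SDim (⊤ : Submodule F L) m n) :
    Module.Finite F L ∧ Module.finrank F L = m + n := by
  obtain ⟨hfin, hm, hn⟩ := hL
  have : Module.Finite F L := Module.Finite.equiv Submodule.topEquiv
  refine ⟨this, ?_⟩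
  rw [top_inf_eq] at hm hn
  rw [← hm, ← hn, Submodule.finrank_add_eq_of_isCompl isCompl]

/-- A graded complement of the derived subalgebra, up to the grading of the latter. -/
theorem exists_graded_sup_derived_eq_top {m n r s : ℕ} (hL : SDim (⊤ : Submodule F L) m n)
    (hL' : SDim (derived F L) r s) : ∃ W : Submodule F L, W ≤ W ⊓ gr 0 ⊔ W ⊓ gr 1 ∧
      W ⊔ derived F L = ⊤ ∧ Module.finrank F W + (r + s) ≤ m + n := by
  have hfin := (finrank_eq_of_sDim_top hL).1
  obtain ⟨-, hm, hn⟩ := hL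
  obtain ⟨-, hr, hs⟩ := hL'
  have key (i : ZMod 2) : ∃ V : Submodule F L, V ≤ gr i ∧ V ⊔ derived F L ⊓ gr i = gr i ∧
      Module.finrank F V + Module.finrank F ↥(derived F L ⊓ gr i) =
        Module.finrank F (gr i : Submodule F L) := by
    -- An arbitrary complement in `L`, cut down to `gr i`, is a complement inside `gr i` by the
    -- modular law.
    obtain ⟨q, hq⟩ := Submodule.exists_isCompl (derived F L ⊓ gr i)
    have hsup : q ⊓ gr i ⊔ derived F L ⊓ gr i = gr i := by
      rw [sup_comm, ← sup_inf_assoc_of_le q inf_le_right, hq.sup_eq_top, top_inf_eq]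
    have hinf : q ⊓ gr i ⊓ (derived F L ⊓ gr i) = ⊥ := by
      rw [← disjoint_iff]
      exact hq.disjoint.symm.mono_left inf_le_left
    refine ⟨q ⊓ gr i, inf_le_right, hsup, ?_⟩
    have := Submodule.finrank_sup_add_finrank_inf_eq (q ⊓ gr i) (derived F L ⊓ gr i)
    rw [hsup, hinf, finrank_bot, add_zero] at this
    exact this.symm
  obtain ⟨V₀, h₀, e₀, d₀⟩ := key 0
  obtain ⟨V₁, h₁, e₁, d₁⟩ := key 1
  refine ⟨V₀ ⊔ V₁, sup_le_sup (le_inf le_sup_left h₀) (le_inf le_sup_right h₁), ?_, ?_⟩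
  · rw [eq_top_iff, ← (isCompl (F := F) (L := L)).sup_eq_top, ← e₀, ← e₁]
    exact sup_le
      (sup_le (le_sup_left.trans le_sup_left) (inf_le_left.trans le_sup_right))
      (sup_le (le_sup_right.trans le_sup_left) (inf_le_left.trans le_sup_right))
  · have := Submodule.finrank_add_le_finrank_add_finrank V₀ V₁
    rw [top_inf_eq] at hm hn
    omega

end Generation

/-! ### The spanning statement and the dimension bound for one tensor product -/

namespace Tensor

variable {F M N : Type*} [Field F] [AddCommGroup M] [Module F M] [LieSuperalgebra F M]
  [AddCommGroup N] [Module F N] [LieSuperalgebra F N]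
  (α : SuperAction F M N) (β : SuperAction F N M)

/-- If `N` is nilpotent, `M ⊗ N` is spanned by the elements `m ⊗ w` where `w` ranges over a graded
subspace which generates `N`. -/
theorem map₂_tens_eq_top (hnil : IsNilpotent F N) {W : Submodule F N}
    (hgr : W ≤ W ⊓ gr 0 ⊔ W ⊓ gr 1) (hW : W ⊔ derived F N = ⊤) :
    Submodule.map₂ (tens α β) ⊤ W = ⊤ := by
  set U := Submodule.map₂ (tens α β) ⊤ W with hU
  let B : Submodule F N :=
    { carrier := {n | ∀ m, tens α β m n ∈ U}
      add_mem' := fun ha hb m => by rw [map_add]; exact add_mem (ha m) (hb m)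
      zero_mem' := fun m => by rw [map_zero]; exact zero_mem _
      smul_mem' := fun c _ ha m => by rw [map_smul]; exact Submodule.smul_mem _ _ (ha m) }
  have hWB : W ≤ B := fun w hw m => Submodule.apply_mem_map₂ _ trivial hw
  -- The relation for `m ⊗ [x, y]` turns it into elements `m' ⊗ x` and `m'' ⊗ y`, and membership in
  -- `B` allows any left factor.
  have hbr : ∀ {i j : ZMod 2} {x y : N}, x ∈ B ⊓ gr i → y ∈ B ⊓ gr j →
      br (F := F) x y ∈ B ⊓ gr (i + j) := by
    rintro i j x y ⟨hx, hxi⟩ ⟨hy, hyj⟩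
    refine ⟨fun m => ?_, br_mem hxi hyj⟩
    rw [← gproj_add (F := F) m, map_add, LinearMap.add_apply,
      tens_br_right α β (gproj_mem 0 m) hxi hyj, tens_br_right α β (gproj_mem 1 m) hxi hyj]
    exact add_mem (sub_mem (Submodule.smul_mem _ _ (hx _)) (Submodule.smul_mem _ _ (hy _)))
      (sub_mem (Submodule.smul_mem _ _ (hx _)) (Submodule.smul_mem _ _ (hy _)))
  have hle (i : ZMod 2) : B ⊓ gr i ≤ B ⊓ gr 0 ⊔ B ⊓ gr 1 := by
    rcases zmod2 i with rfl | rfl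
    exacts [le_sup_left, le_sup_right]
  -- `B` is closed only under brackets of homogeneous elements and is not known to be graded, so the
  -- generation lemma is applied to the span of its homogeneous elements.
  have htop : B ⊓ gr 0 ⊔ B ⊓ gr 1 = ⊤ := by
    refine eq_top_of_sup_derived_eq_top hnil ?_ ?_
    · rw [eq_top_iff, ← hW]
      exact sup_le_sup_right
        (hgr.trans (sup_le_sup (inf_le_inf_right _ hWB) (inf_le_inf_right _ hWB))) _
    · intro x hx y hy
      obtain ⟨x₀, hx₀, x₁, hx₁, rfl⟩ := Submodule.mem_sup.1 hx
      obtain ⟨y₀, hy₀, y₁, hy₁, rfl⟩ := Submodule.mem_sup.1 hy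
      simp only [map_add, LinearMap.add_apply]
      exact add_mem (add_mem (hle _ (hbr hx₀ hy₀)) (hle _ (hbr hx₁ hy₀)))
        (add_mem (hle _ (hbr hx₀ hy₁)) (hle _ (hbr hx₁ hy₁)))
  have hB : ∀ n, n ∈ B := fun n =>
    (sup_le inf_le_left inf_le_left : B ⊓ gr 0 ⊔ B ⊓ gr 1 ≤ B) (htop.ge trivial)
  rw [eq_top_iff, ← span_tens, Submodule.span_le]
  rintro _ ⟨i, j, m, n, -, -, rfl⟩
  exact hB n m

/-- The map `M ⊗_F W → M ⊗ N` of vector spaces. -/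
noncomputable def ofTensorProduct (W : Submodule F N) : M ⊗[F] W →ₗ[F] Tensor α β :=
  TensorProduct.lift ((tens α β).compl₂ W.subtype)

theorem ofTensorProduct_tmul (W : Submodule F N) (m : M) (w : W) :
    ofTensorProduct α β W (m ⊗ₜ w) = tens α β m w := rfl

theorem ofTensorProduct_surjective (hnil : IsNilpotent F N) {W : Submodule F N}
    (hgr : W ≤ W ⊓ gr 0 ⊔ W ⊓ gr 1) (hW : W ⊔ derived F N = ⊤) :
    Function.Surjective (ofTensorProduct α β W) := by
  rw [← LinearMap.range_eq_top, eq_top_iff, ← map₂_tens_eq_top α β hnil hgr hW]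
  exact Submodule.map₂_le.2 fun m _ w hw => ⟨m ⊗ₜ ⟨w, hw⟩, rfl⟩

theorem finite_and_finrank_le [Module.Finite F M] [Module.Finite F N] (hnil : IsNilpotent F N)
    {W : Submodule F N} (hgr : W ≤ W ⊓ gr 0 ⊔ W ⊓ gr 1) (hW : W ⊔ derived F N = ⊤) :
    Module.Finite F (Tensor α β) ∧
      Module.finrank F (Tensor α β) ≤ Module.finrank F M * Module.finrank F W := by
  have h := ofTensorProduct_surjective α β hnil hgr hW
  refine ⟨Module.Finite.of_surjective _ h, ?_⟩
  rw [← Module.finrank_tensorProduct]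
  exact LinearMap.finrank_le_finrank_of_surjective h

/-- If the bound on the dimension of `M ⊗ N` is attained, then `m ⊗ w` does not vanish for nonzero
`m` and nonzero `w` in the generating subspace. -/
theorem eq_zero_or_eq_zero_of_tens_eq_zero [Module.Finite F M] [Module.Finite F N]
    (hnil : IsNilpotent F N) {W : Submodule F N} (hgr : W ≤ W ⊓ gr 0 ⊔ W ⊓ gr 1)
    (hW : W ⊔ derived F N = ⊤)
    (hdim : Module.finrank F M * Module.finrank F W ≤ Module.finrank F (Tensor α β))
    {m : M} {w : N} (hw : w ∈ W) (h : tens α β m w = 0) : m = 0 ∨ w = 0 := by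
  have hs := ofTensorProduct_surjective α β hnil hgr hW
  have := Module.Finite.of_surjective _ hs
  have hd : Module.finrank F (M ⊗[F] W) = Module.finrank F (Tensor α β) :=
    le_antisymm (by rwa [Module.finrank_tensorProduct])
      (LinearMap.finrank_le_finrank_of_surjective hs)
  -- A surjection between spaces of equal finite dimension is injective, so the vanishing can be
  -- pulled back to `M ⊗_F W`, where a product of two functionals detects `m ⊗ w`.
  have hi := (LinearMap.injective_iff_surjective_of_finrank_eq_finrank hd).2 hs
  have h0 : m ⊗ₜ[F] (⟨w, hw⟩ : W) = 0 :=
    hi ((ofTensorProduct_tmul α β W m ⟨w, hw⟩).trans (h.trans (map_zero _).symm))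
  by_contra! hne
  obtain ⟨f, hf⟩ : ∃ f : Module.Dual F M, f m ≠ 0 := by
    by_contra! h
    exact hne.1 ((Module.forall_dual_apply_eq_zero_iff F m).1 h)
  obtain ⟨g, hg⟩ : ∃ g : Module.Dual F N, g w ≠ 0 := by
    by_contra! h
    exact hne.2 ((Module.forall_dual_apply_eq_zero_iff F w).1 h)
  have := congrArg (TensorProduct.lift ((LinearMap.mul F F).compl₁₂ f (g ∘ₗ W.subtype))) h0
  simp [hf, hg] at this

end Tensor

/-! ### Derived subalgebra an even line: recognizing `H(1 ∣ 0)` -/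

section EvenLine

variable {F L : Type*} [Field F] [AddCommGroup L] [Module F L] [LieSuperalgebra F L]

theorem br_self_even (hF2 : ringChar F ≠ 2) {x : L} (hx : x ∈ (gr 0 : Submodule F L)) :
    br (F := F) x x = 0 := by
  have h := br_skew hx hx
  have : (2 : F) • br (F := F) x x = 0 := by
    rw [ksgn_zero_left, one_smul] at h
    linear_combination (norm := module) h
  exact (smul_eq_zero.1 this).resolve_left (Ring.two_ne_zero hF2)

/-- The odd component of a bracket is again a sum of brackets, so it lies in the zero space `[L, L]
⊓ gr 1`. -/
theorem derived_le_gr_zero (hL' : SDim (derived F L) 1 0) : derived F L ≤ gr 0 := by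
  obtain ⟨hfin, -, h1⟩ := hL'
  have : Module.Finite F ↥(derived F L ⊓ gr 1) :=
    Submodule.finiteDimensional_of_le (S₂ := derived F L) inf_le_left
  have hbot := Submodule.finrank_eq_zero.1 h1
  refine Submodule.map₂_le.2 fun x _ y _ => ?_
  have h0 : gproj F 1 (br (F := F) x y) = 0 := by
    have : gproj F 1 (br (F := F) x y) ∈ derived F L ⊓ gr 1 := by
      refine ⟨?_, gproj_mem _ _⟩
      rw [gproj_br]
      exact add_mem (br_mem_derived _ _) (br_mem_derived _ _)
    simpa [hbot] using this
  rw [← gproj_add (F := F) (br (F := F) x y), h0, add_zero]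
  exact gproj_mem _ _

theorem derived_eq_span (hL' : SDim (derived F L) 1 0) {z : L} (hz : z ∈ derived F L)
    (hz0 : z ≠ 0) : derived F L = Submodule.span F {z} := by
  have h1 : Module.finrank F (derived F L) = 1 := by
    have := hL'.2.1
    rwa [inf_eq_left.2 (derived_le_gr_zero hL')] at this
  have := hL'.1
  refine (Submodule.eq_of_le_of_finrank_eq ?_ ?_).symm
  · rwa [Submodule.span_singleton_le_iff_mem]
  · rw [h1, finrank_span_singleton hz0]

/-- Since `[L, L]` is a line, `[z, x] = c • z`. If `c ≠ 0`, then `z` survives in every term of the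
descending central series, against nilpotency. -/
theorem br_derived_left (hL' : SDim (derived F L) 1 0) (hnil : IsNilpotent F L) {z : L}
    (hz : z ∈ derived F L) (x : L) : br (F := F) z x = 0 := by
  by_contra h
  have hz0 : z ≠ 0 := by rintro rfl; simp at h
  obtain ⟨c, hc⟩ : ∃ c : F, c • z = br (F := F) z x := by
    rw [← Submodule.mem_span_singleton, ← derived_eq_span hL' hz hz0]
    exact br_mem_derived _ _
  have hc0 : c ≠ 0 := by rintro rfl; exact h (by rw [← hc, zero_smul])
  have hmem : ∀ k, z ∈ lcs F L k := by
    intro k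
    induction k with
    | zero => trivial
    | succ k ih =>
      rw [← inv_smul_smul₀ hc0 z, hc]
      exact Submodule.smul_mem _ _ (Submodule.apply_mem_map₂ _ ih trivial)
  obtain ⟨k, hk⟩ := hnil
  have := hmem k
  rw [hk] at this
  exact hz0 this

theorem br_derived_right (hL' : SDim (derived F L) 1 0) (hnil : IsNilpotent F L) {z : L}
    (hz : z ∈ derived F L) (x : L) : br (F := F) x z = 0 := by
  have hz0 := derived_le_gr_zero hL' hz
  rw [← gproj_add (F := F) x, map_add, LinearMap.add_apply, br_skew (gproj_mem 0 x) hz0,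
    br_skew (gproj_mem 1 x) hz0]
  simp [br_derived_left hL' hnil hz]

theorem br_even_odd (hL' : SDim (derived F L) 1 0) {x y : L} (hx : x ∈ (gr 0 : Submodule F L))
    (hy : y ∈ (gr 1 : Submodule F L)) : br (F := F) x y = 0 := by
  have h1 : br (F := F) x y ∈ (gr 1 : Submodule F L) := by simpa using br_mem hx hy
  exact Submodule.disjoint_def.1 isCompl.disjoint _
    (derived_le_gr_zero hL' (br_mem_derived x y)) h1

/-- Expanding `[x, y] ⊗ z'` by the left relation leaves only brackets with the central element `z'`.
-/
theorem tens_derived_derived (hL' : SDim (derived F L) 1 0) (hnil : IsNilpotent F L) {z z' : L}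
    (hz : z ∈ derived F L) (hz' : z' ∈ derived F L) : Square.tens F L z z' = 0 := by
  have hz0 := derived_le_gr_zero hL' hz'
  have : derived F L ≤ LinearMap.ker ((Square.tens F L).flip z') := by
    refine Submodule.map₂_le.2 fun x _ y _ => ?_
    rw [LinearMap.mem_ker, LinearMap.flip_apply, ← gproj_add (F := F) x, ← gproj_add (F := F) y]
    simp only [map_add, LinearMap.add_apply]
    simp only [Square.tens_br_left (gproj_mem _ x) (gproj_mem _ y) hz0,
      br_derived_right hL' hnil hz', map_zero, smul_zero, sub_zero, add_zero]
  exact this hz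

/-- An odd element whose square spans the derived subalgebra gives a relation in the tensor
square, when the characteristic is not `3`. -/
theorem tens_br_self_odd (hF3 : ringChar F ≠ 3) {y : L} (hy : y ∈ (gr 1 : Submodule F L)) :
    Square.tens F L (br (F := F) y y) y = 0 := by
  have h3 : (3 : F) ≠ 0 := by
    intro h
    have h' : ringChar F ∣ 3 := ringChar.dvd (by exact_mod_cast h)
    rcases (Nat.dvd_prime Nat.prime_three).1 h' with h1 | h1
    · exact CharP.ringChar_ne_one h1
    · exact hF3 h1
  -- For odd `y` the signs give `[y, y] ⊗ y = 2 • (y ⊗ [y, y])` and `y ⊗ [y, y] = 2 • ([y, y] ⊗ y)`.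
  -- Together, `[y, y] ⊗ y` equals four times itself.
  have e1 := Square.tens_br_left hy hy hy
  have e2 := Square.tens_br_right hy hy hy
  simp only [one_one, ksgn_one_one, ksgn_zero_right] at e1 e2
  have : (3 : F) • Square.tens F L (br (F := F) y y) y = 0 := by
    linear_combination (norm := module) (-1 : F) • e1 - (2 : F) • e2
  exact (smul_eq_zero.1 this).resolve_left h3

/-- Mixed brackets vanish because `[L, L]` is even, and the bracket on odd elements is symmetric, so
away from characteristic `2` polarization recovers it from its squares. -/
theorem exists_even_pair_or_odd_square (hF2 : ringChar F ≠ 2) (hL' : SDim (derived F L) 1 0)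
    (hna : ¬ IsAbelian F L) :
    (∃ a ∈ (gr 0 : Submodule F L), ∃ b ∈ (gr 0 : Submodule F L), br (F := F) a b ≠ 0) ∨
      ∃ y ∈ (gr 1 : Submodule F L), br (F := F) y y ≠ 0 := by
  by_contra! h
  obtain ⟨h0, h1⟩ := h
  have h2 : (2 : F) ≠ 0 := Ring.two_ne_zero hF2
  have h11 : ∀ x ∈ (gr 1 : Submodule F L), ∀ y ∈ (gr 1 : Submodule F L), br (F := F) x y = 0 := by
    intro x hx y hy
    have e := h1 _ (add_mem hx hy)
    have s := br_skew hy hx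
    simp only [map_add, LinearMap.add_apply, h1 x hx, h1 y hy, ksgn_one_one] at e s
    have : (2 : F) • br (F := F) x y = 0 := by
      linear_combination (norm := module) e - s
    exact (smul_eq_zero.1 this).resolve_left h2
  refine hna fun x y => ?_
  rw [← gproj_add (F := F) x, ← gproj_add (F := F) y]
  have h10 : br (F := F) (gproj F 1 x) (gproj F 0 y) = 0 := by
    rw [br_skew (gproj_mem 1 x) (gproj_mem 0 y),
      br_even_odd hL' (gproj_mem 0 y) (gproj_mem 1 x), smul_zero, neg_zero]
  simp only [map_add, LinearMap.add_apply, h10, br_even_odd hL' (gproj_mem 0 x) (gproj_mem 1 y),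
    h0 _ (gproj_mem 0 x) _ (gproj_mem 0 y), h11 _ (gproj_mem 1 x) _ (gproj_mem 1 y), add_zero]

/-- The source of unwanted relations: anything commuting with `a` and `b` is annihilated by `[a, b]
⊗ -`. It serves both to exclude odd elements and to bound the even part. -/
theorem tens_br_eq_zero {a b w : L} {k : ZMod 2} (ha : a ∈ (gr 0 : Submodule F L))
    (hb : b ∈ (gr 0 : Submodule F L)) (hw : w ∈ (gr k : Submodule F L))
    (haw : br (F := F) a w = 0) (hbw : br (F := F) b w = 0) :
    Square.tens F L (br (F := F) a b) w = 0 := by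
  rw [Square.tens_br_left ha hb hw, haw, hbw]
  simp

/-- A Lie superalgebra which is spanned by even elements `a`, `b` and the central element `[a, b]`
is isomorphic to `H(1 ∣ 0)`. -/
theorem nonempty_sEquiv_heisenberg (hF2 : ringChar F ≠ 2) {a b : L} (ha : a ∈ (gr 0 : Submodule F L))
    (hb : b ∈ (gr 0 : Submodule F L)) (hab : br (F := F) a b ≠ 0)
    (hl : ∀ x, br (F := F) (br (F := F) a b) x = 0)
    (hr : ∀ x, br (F := F) x (br (F := F) a b) = 0)
    (hodd : (gr 1 : Submodule F L) = ⊥)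
    (hspan : ∀ x : L, ∃ p q c : F, x = p • a + q • b + c • br (F := F) a b) :
    Nonempty (SEquiv F L (Heisenberg F 1 0)) := by
  have hself : ∀ x ∈ (gr 0 : Submodule F L), br (F := F) x x = 0 := fun _ => br_self_even hF2
  have hba : br (F := F) b a = -br (F := F) a b := by simpa using br_skew hb ha
  let g : Heisenberg F 1 0 →ₗ[F] L :=
    { toFun := fun h => h.1 0 • a + h.2.1 0 • b + h.2.2.1 • br (F := F) a b
      map_add' := fun h h' => by simp only [Prod.fst_add, Prod.snd_add, Pi.add_apply]; module
      map_smul' := fun c h => by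
        simp only [Prod.smul_fst, Prod.smul_snd, Pi.smul_apply, smul_eq_mul, RingHom.id_apply]
        module }
  have hg : ∀ h, g h = h.1 0 • a + h.2.1 0 • b + h.2.2.1 • br (F := F) a b := fun _ => rfl
  have hgbr : ∀ h h', g (br (F := F) h h') = br (F := F) (g h) (g h') := by
    intro h h'
    change g (Heisenberg.bracket F 1 0 h h') = _
    simp only [Heisenberg.bracket_apply, hg, Heisenberg.form, map_add, map_smul,
      LinearMap.add_apply, LinearMap.smul_apply, hl, hr, hself a ha, hself b hb, hba]
    simp
    module
  have hinj : Function.Injective g := by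
    rw [← LinearMap.ker_eq_bot, LinearMap.ker_eq_bot']
    intro h hh
    rw [hg] at hh
    -- Bracketing with `a` isolates the coefficient of `b`, bracketing with `b` that of `a`; the
    -- coefficient of `[a, b]` is then all that remains.
    have e1 := congrArg (br (F := F) a) hh
    have e2 := congrArg (br (F := F) b) hh
    simp only [map_add, map_smul, hself a ha, hself b hb, hba, hr, smul_zero, zero_add, add_zero,
      map_zero, smul_neg, neg_eq_zero, smul_eq_zero, hab, or_false] at e1 e2
    simp only [e1, e2, zero_smul, zero_add, smul_eq_zero, hab, or_false] at hh
    refine Prod.ext ?_ (Prod.ext ?_ (Prod.ext hh (Subsingleton.elim _ _)))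
    · ext i; rw [Subsingleton.elim i 0]; exact e2
    · ext i; rw [Subsingleton.elim i 0]; exact e1
  have hsurj : Function.Surjective g := by
    intro x
    obtain ⟨p, q, c, rfl⟩ := hspan x
    exact ⟨(fun _ => p, fun _ => q, c, 0), rfl⟩
  let e := LinearEquiv.ofBijective g ⟨hinj, hsurj⟩
  refine ⟨⟨e.symm, ?_, ?_⟩⟩
  · intro i x hx
    rcases zmod2 i with rfl | rfl
    · exact (Heisenberg.mem_part_zero F 1 0 _).2 (Subsingleton.elim _ _)
    · rw [hodd, Submodule.mem_bot] at hx
      rw [hx, map_zero]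
      exact zero_mem _
  · intro x y
    apply e.injective
    rw [e.apply_symm_apply]
    exact ((hgbr _ _).trans (congrArg₂ (fun u v => br (F := F) u v) (e.apply_symm_apply x)
      (e.apply_symm_apply y))).symm

/-- If `z ⊗ w` vanishes only for `w` in the line `[L, L]`, where `z` spans `[L, L]`, then `L` is
isomorphic to `H(1 ∣ 0)`. -/
theorem nonempty_sEquiv_heisenberg_of_tens_ne_zero (hF2 : ringChar F ≠ 2) (hF3 : ringChar F ≠ 3)
    (hL' : SDim (derived F L) 1 0) (hna : ¬ IsAbelian F L) (hnil : IsNilpotent F L)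
    (h : ∀ z ∈ derived F L, z ≠ 0 → ∀ w, Square.tens F L z w = 0 → w ∈ derived F L) :
    Nonempty (SEquiv F L (Heisenberg F 1 0)) := by
  have hdisj := Submodule.disjoint_def.1 (isCompl (F := F) (L := L)).disjoint
  rcases exists_even_pair_or_odd_square hF2 hL' hna with ⟨a, ha, b, hb, hab⟩ | ⟨y, hy, hyy⟩
  · have hz := br_mem_derived (F := F) a b
    have hba : br (F := F) b a = -br (F := F) a b := by simpa using br_skew hb ha
    have hodd : (gr 1 : Submodule F L) = ⊥ := by
      rw [eq_bot_iff]
      intro w hw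
      exact hdisj w (derived_le_gr_zero hL' (h _ hz hab w
        (tens_br_eq_zero ha hb hw (br_even_odd hL' ha hw) (br_even_odd hL' hb hw)))) hw
    have heven : ∀ x : L, x ∈ (gr 0 : Submodule F L) := by
      have := (isCompl (F := F) (L := L)).sup_eq_top
      rw [hodd, sup_bot_eq] at this
      simp [this]
    have hline : ∀ x ∈ derived F L, ∃ c : F, c • br (F := F) a b = x := by
      intro x hx
      rwa [derived_eq_span hL' hz hab, Submodule.mem_span_singleton] at hx
    refine nonempty_sEquiv_heisenberg hF2 ha hb hab (br_derived_left hL' hnil hz)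
      (br_derived_right hL' hnil hz) hodd fun x => ?_
    obtain ⟨p, hp⟩ := hline _ (br_mem_derived a x)
    obtain ⟨q, hq⟩ := hline _ (br_mem_derived b x)
    -- With `[a, x] = p • z` and `[b, x] = q • z`, where `z = [a, b]`, this is the correction of `x`
    -- that commutes with both `a` and `b`; note `[b, a] = -z`.
    have hx := h _ hz hab (x - p • b + q • a) (tens_br_eq_zero ha hb (heven _) ?_ ?_)
    · obtain ⟨c, hc⟩ := hline _ hx
      refine ⟨-q, p, c, ?_⟩
      rw [hc]
      module
    · simp [← hp, br_self_even hF2 ha]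
    · simp [← hq, br_self_even hF2 hb, hba]
  · have hz := br_mem_derived (F := F) y y
    -- Here `y` would be both odd and, as an element of `[L, L]`, even, hence zero.
    have := hdisj y (derived_le_gr_zero hL' (h _ hz hyy y (tens_br_self_odd hF3 hy))) hy
    exact absurd (by simp [this]) hyy

end EvenLine

/-! ### Linear maps out of a tensor product, for lower bounds -/

namespace Tensor

variable {F M N V : Type*} [Field F] [AddCommGroup M] [Module F M] [LieSuperalgebra F M]
  [AddCommGroup N] [Module F N] [LieSuperalgebra F N] [AddCommGroup V] [Module F V]
  (α : SuperAction F M N) (β : SuperAction F N M)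

/-- The value of a word: `B` on the symbols, zero on the products. -/
def wordValue (B : M →ₗ[F] N →ₗ[F] V) : FreeMagma (Sym F M N) → V
  | .of s => B s.left s.right
  | .mul _ _ => 0

/-- A bilinear map which respects the relations of `M ⊗ N`, when all brackets are sent to `0`,
extends to a linear map on `M ⊗ N`. -/
theorem exists_linearMap_of_bilinear (B : M →ₗ[F] N →ₗ[F] V)
    (h₁ : ∀ {i i' j : ZMod 2} {m m' : M} {n : N}, m ∈ (gr i : Submodule F M) →
      m' ∈ (gr i' : Submodule F M) → n ∈ (gr j : Submodule F N) →
      B (br (F := F) m m') n = B m (α.act m' n) - ksgn F i i' • B m' (α.act m n))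
    (h₂ : ∀ {i j j' : ZMod 2} {m : M} {n n' : N}, m ∈ (gr i : Submodule F M) →
      n ∈ (gr j : Submodule F N) → n' ∈ (gr j' : Submodule F N) →
      B m (br (F := F) n n') =
        ksgn F j' (i + j) • B (β.act n' m) n - ksgn F i j • B (β.act n m) n')
    (h₃ : ∀ (m m' : M) (n n' : N), B (β.act n m) (α.act m' n') = 0) :
    ∃ f : Tensor α β →ₗ[F] V, ∀ m n, f (tens α β m n) = B m n := by
  let g : FreeNA F (Sym F M N) →ₗ[F] V := Finsupp.linearCombination F (wordValue B)
  have hgen : ∀ {i j : ZMod 2} {m : M} {n : N} (hm : m ∈ (gr i : Submodule F M))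
      (hn : n ∈ (gr j : Submodule F N)), g (symGen hm hn) = B m n := fun hm hn => by
    simp [g, symGen, FreeNA.gen, wordValue]
  have hmul : ∀ a b, g (FreeNA.mul F _ a b) = 0 := by
    intro a b
    have : (FreeNA.mul F (Sym F M N)).compr₂ g = 0 := by
      refine Finsupp.lhom_ext' fun u => LinearMap.ext_ring (Finsupp.lhom_ext' fun v =>
        LinearMap.ext_ring ?_)
      simp [FreeNA.mul_single, g, wordValue]
    exact LinearMap.congr_fun₂ this a b
  have hle : idealGen F Sym.deg (TensorRel α β) ≤ LinearMap.ker g := by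
    intro a ha
    rw [LinearMap.mem_ker]
    change IdealGen F Sym.deg (TensorRel α β) a at ha
    induction ha with
    | rel h =>
      cases h with
      | smul_left c hm hn => simp [hgen]
      | smul_right c hm hn => simp [hgen]
      | add_left hm hm' hn => simp [hgen]
      | add_right hm hn hn' => simp [hgen]
      | br_left hm hm' hn => simp only [map_sub, map_smul, hgen, h₁ hm hm' hn, sub_self]
      | br_right hm hn hn' => simp only [map_sub, map_smul, hgen, h₂ hm hn hn', sub_self]
      | br_br hm hn hm' hn' =>
        simp only [map_sub, map_neg, map_smul, hgen, hmul, h₃, smul_zero, neg_zero, sub_zero]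
    | zero => exact map_zero _
    | add _ _ h1 h2 => rw [map_add, h1, h2, add_zero]
    | smul c _ h => rw [map_smul, h, smul_zero]
    -- The remaining cases are skew-symmetry, Jacobi and the two ideal closures: all are
    -- combinations of products, which `g` annihilates.
    | _ => simp only [map_add, map_smul, hmul, smul_zero, add_zero]
  refine ⟨(idealGen F Sym.deg (TensorRel α β)).liftQ g hle, fun m n => ?_⟩
  have hext : (tens α β).compr₂ ((idealGen F Sym.deg (TensorRel α β)).liftQ g hle) = B := by
    refine ext_homogeneous (F := F) fun i m hm => ext_homogeneous (F := F) fun j n hn => ?_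
    rw [LinearMap.compr₂_apply, ← mk_symGen α β hm hn]
    exact hgen hm hn
  exact LinearMap.congr_fun₂ hext m n

end Tensor

/-! ### Coordinates on a copy of `H(1 ∣ 0)` -/

section HeisenbergCoordinates

/-- Coordinates on a Lie superalgebra which identify it with `H(1 ∣ 0)`: the bracket is the
standard symplectic form in the first two coordinates, times the third basis vector. -/
structure HeisenbergCoordinates (F L : Type*) [Field F] [AddCommGroup L] [Module F L]
    [LieSuperalgebra F L] where
  p : L →ₗ[F] F
  q : L →ₗ[F] F
  c : L →ₗ[F] F
  a : L
  b : L
  z : L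
  p_a : p a = 1
  q_a : q a = 0
  c_a : c a = 0
  p_b : p b = 0
  q_b : q b = 1
  c_b : c b = 0
  p_z : p z = 0
  q_z : q z = 0
  c_z : c z = 1
  eq_sum : ∀ x, x = p x • a + q x • b + c x • z
  br_eq : ∀ x y, br (F := F) x y = (p x * q y - q x * p y) • z
  odd : (gr 1 : Submodule F L) = ⊥

variable {F L : Type*} [Field F] [AddCommGroup L] [Module F L] [LieSuperalgebra F L]

/-- The coordinates attached to an isomorphism with `H(1 ∣ 0)`. -/
def SEquiv.coordinates (e : SEquiv F L (Heisenberg F 1 0)) : HeisenbergCoordinates F L where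
  p := LinearMap.proj 0 ∘ₗ LinearMap.fst F _ _ ∘ₗ e.toLinearEquiv.toLinearMap
  q := LinearMap.proj 0 ∘ₗ LinearMap.fst F _ _ ∘ₗ LinearMap.snd F _ _ ∘ₗ
    e.toLinearEquiv.toLinearMap
  c := LinearMap.fst F _ _ ∘ₗ LinearMap.snd F _ _ ∘ₗ LinearMap.snd F _ _ ∘ₗ
    e.toLinearEquiv.toLinearMap
  a := e.toLinearEquiv.symm (1, 0, 0, 0)
  b := e.toLinearEquiv.symm (0, 1, 0, 0)
  z := e.toLinearEquiv.symm (0, 0, 1, 0)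
  p_a := by simp
  q_a := by simp
  c_a := by simp
  p_b := by simp
  q_b := by simp
  c_b := by simp
  p_z := by simp
  q_z := by simp
  c_z := by simp
  eq_sum x := by
    apply e.toLinearEquiv.injective
    simp only [map_add, map_smul, LinearEquiv.apply_symm_apply]
    refine Prod.ext ?_ (Prod.ext ?_ (Prod.ext ?_ (Subsingleton.elim _ _)))
    · ext i; rw [Subsingleton.elim i 0]; simp
    · ext i; rw [Subsingleton.elim i 0]; simp
    · simp
  br_eq x y := by
    apply e.toLinearEquiv.injective
    rw [e.map_br, map_smul, LinearEquiv.apply_symm_apply]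
    change Heisenberg.bracket F 1 0 _ _ = _
    rw [Heisenberg.bracket_apply, Heisenberg.form]
    simp
  odd := by
    rw [eq_bot_iff]
    intro x hx
    obtain ⟨h1, h2, h3⟩ := (Heisenberg.mem_part_one F 1 0 _).1 (e.map_gr 1 x hx)
    exact e.toLinearEquiv.map_eq_zero_iff.1
      (Prod.ext h1 (Prod.ext h2 (Prod.ext h3 (Subsingleton.elim _ _))))

end HeisenbergCoordinates

/-! ### Lower bounds for the square and the triple product of `H(1 ∣ 0)` -/

section HeisenbergTensor

variable {F L : Type*} [Field F] [AddCommGroup L] [Module F L] [LieSuperalgebra F L]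

namespace HeisenbergCoordinates

variable (H : HeisenbergCoordinates F L)
include H

/-- With no odd part, every element is homogeneous of degree zero: the relations hold for arbitrary
elements and without signs. -/
theorem mem_gr_zero (x : L) : x ∈ (gr 0 : Submodule F L) := by
  have := (isCompl (F := F) (L := L)).sup_eq_top
  rw [H.odd, sup_bot_eq] at this
  simp [this]

theorem eq_zero_of_mem_gr_one {x : L} (hx : x ∈ (gr 1 : Submodule F L)) : x = 0 := by
  simpa [H.odd] using hx

theorem br_br_left (x y w : L) : br (F := F) (br (F := F) x y) w = 0 := by
  rw [H.br_eq x y, H.br_eq]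
  simp [H.p_z, H.q_z]

theorem br_br_right (x y w : L) : br (F := F) w (br (F := F) x y) = 0 := by
  rw [H.br_eq x y, H.br_eq]
  simp [H.p_z, H.q_z]

theorem tens_br_left (x y w : L) : Square.tens F L (br (F := F) x y) w =
    Square.tens F L x (br (F := F) y w) - Square.tens F L y (br (F := F) x w) := by
  simpa using Square.tens_br_left (H.mem_gr_zero x) (H.mem_gr_zero y) (H.mem_gr_zero w)

theorem tens_br_br (x y x' y' : L) :
    Square.tens F L (br (F := F) x y) (br (F := F) x' y') = 0 := by
  rw [H.tens_br_left, H.br_br_right, H.br_br_right, map_zero, map_zero, sub_zero]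

theorem act_tens (l x y : L) : Square.act F L l (Square.tens F L x y) =
    Square.tens F L (br (F := F) l x) y + Square.tens F L x (br (F := F) l y) := by
  simpa using Square.act_tens (H.mem_gr_zero l) (H.mem_gr_zero x) (H.mem_gr_zero y)

/-- Brackets in `L ⊗ L` are multiples of `z ⊗ z`, which is zero. So sending all products to zero, as
the extension lemma does, loses nothing here. -/
theorem br_square (s t : Square F L) : br (F := F) s t = 0 := by
  have : (br : Square F L →ₗ[F] Square F L →ₗ[F] Square F L) = 0 := by
    refine Tensor.ext_tens _ _ fun _ _ x y _ _ => Tensor.ext_tens _ _ fun _ _ x' y' _ _ => ?_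
    rw [Square.br_tens (H.mem_gr_zero x) (H.mem_gr_zero y) (H.mem_gr_zero x') (H.mem_gr_zero y'),
      H.tens_br_br]
    simp
  simp [this]

/-- The action passes through `Square.lam`, whose values are combinations of brackets and hence
central. -/
theorem actOnBase_act (t : Square F L) (x : L) : (Square.actOnBase F L).act t x = 0 := by
  have : (Square.actOnBase F L).act = 0 := by
    refine Tensor.ext_tens _ _ fun _ _ a b _ _ => LinearMap.ext fun x => ?_
    change br (F := F) (Square.lam F L (Square.tens F L a b)) x = 0
    rw [Square.lam_tens, H.br_br_left]
  simp [this]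

/-- Two applications produce either a double bracket in one factor or a bracket in each factor; the
former vanish by class two, the latter by `z ⊗ z = 0`. -/
theorem act_act (l l' : L) (t : Square F L) : Square.act F L l (Square.act F L l' t) = 0 := by
  have : Square.act F L l ∘ₗ Square.act F L l' = 0 := by
    refine Tensor.ext_tens _ _ fun _ _ a b _ _ => ?_
    rw [LinearMap.comp_apply, H.act_tens, map_add, H.act_tens, H.act_tens]
    simp [H.tens_br_br, H.br_br_right]
  exact LinearMap.congr_fun this t

theorem br_a_b : br (F := F) H.a H.b = H.z := by
  rw [H.br_eq]
  simp [H.p_a, H.q_a, H.q_b, H.p_b]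

theorem act_z (t : Square F L) : Square.act F L H.z t = 0 := by
  have : Square.act F L H.z = 0 := by
    refine Tensor.ext_tens _ _ fun _ _ a b _ _ => ?_
    rw [← H.br_a_b, H.act_tens]
    simp [H.br_br_left]
  simp [this]

theorem act_eq (l : L) (t : Square F L) : Square.act F L l t =
    H.p l • Square.act F L H.a t + H.q l • Square.act F L H.b t := by
  conv_lhs => rw [H.eq_sum l]
  simp [H.act_z]

theorem p_br (x y : L) : H.p (br (F := F) x y) = 0 := by simp [H.br_eq, H.p_z]

theorem q_br (x y : L) : H.q (br (F := F) x y) = 0 := by simp [H.br_eq, H.q_z]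

theorem c_br (x y : L) : H.c (br (F := F) x y) = H.p x * H.q y - H.q x * H.p y := by
  simp [H.br_eq, H.c_z]

/-- The coordinates on the tensor square: the tensor square of the abelianization and
the two coordinates of `z ⊗ a` and `z ⊗ b`. -/
def squareForm : L →ₗ[F] L →ₗ[F] F × F × F × F × F × F :=
  LinearMap.mk₂ F
    (fun x y => (H.p x * H.p y, H.p x * H.q y, H.q x * H.p y, H.q x * H.q y,
      -- The last two entries are antisymmetric because the relations force `a ⊗ z = -(z ⊗ a)` and
      -- `b ⊗ z = -(z ⊗ b)`.
      H.c x * H.p y - H.p x * H.c y, H.c x * H.q y - H.q x * H.c y))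
    (fun x x' y => by ext <;> simp <;> ring)
    (fun k x y => by ext <;> simp <;> ring)
    (fun x y y' => by ext <;> simp <;> ring)
    (fun k x y => by ext <;> simp <;> ring)

theorem squareForm_apply (x y : L) : H.squareForm x y =
    (H.p x * H.p y, H.p x * H.q y, H.q x * H.p y, H.q x * H.q y,
      H.c x * H.p y - H.p x * H.c y, H.c x * H.q y - H.q x * H.c y) := rfl

theorem six_le_finrank_square [Module.Finite F (Square F L)] :
    6 ≤ Module.finrank F (Square F L) := by
  have hz : ∀ {i : ZMod 2} {x : L}, x ∈ (gr i : Submodule F L) → i = 0 ∨ x = 0 := by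
    intro i x hx
    rcases zmod2 i with rfl | rfl
    exacts [.inl rfl, .inr (H.eq_zero_of_mem_gr_one hx)]
  obtain ⟨f, hf⟩ := Tensor.exists_linearMap_of_bilinear (adjoint F L) (adjoint F L) H.squareForm
    (by
      intro i i' j x x' y hx hx' hy
      rcases hz hx with rfl | rfl
      · rw [ksgn_zero_left, one_smul]
        simp only [squareForm_apply, adjoint_act, p_br, q_br, c_br]
        -- In the last two coordinates this is the identity `ω(x, x') y + ω(x', y) x + ω(y, x) x' =
        -- 0` for three vectors of the plane with coordinates `p`, `q`, where `ω` is its symplectic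
        -- form.
        ext <;> simp <;> ring
      · simp)
    (by
      intro i j j' x y y' hx hy hy'
      rcases hz hy with rfl | rfl
      · rcases hz hy' with rfl | rfl
        · rw [ksgn_zero_left, ksgn_zero_right, one_smul, one_smul]
          simp only [squareForm_apply, adjoint_act, p_br, q_br, c_br]
          ext <;> simp <;> ring
        · simp
      · simp)
    (by
      intro x x' y y'
      simp only [squareForm_apply, adjoint_act, p_br, q_br]
      simp)
  have hs : Function.Surjective f := by
    rintro ⟨v₁, v₂, v₃, v₄, v₅, v₆⟩
    refine ⟨v₁ • Square.tens F L H.a H.a + v₂ • Square.tens F L H.a H.b +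
      v₃ • Square.tens F L H.b H.a + v₄ • Square.tens F L H.b H.b +
      v₅ • Square.tens F L H.z H.a + v₆ • Square.tens F L H.z H.b, ?_⟩
    simp only [map_add, map_smul, hf, squareForm_apply, H.p_a, H.q_a, H.c_a, H.p_b, H.q_b, H.c_b,
      H.p_z, H.q_z, H.c_z]
    ext <;> simp
  simpa using LinearMap.finrank_le_finrank_of_surjective hs

/-- The coordinates of `t ⊗ x` with respect to `a` and `b` in the triple tensor product. -/
noncomputable def tripleForm : Square F L →ₗ[F] L →ₗ[F] Square F L × Square F L :=
  LinearMap.mk₂ F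
    -- The terms in `c` are dictated by `t ⊗ z = t ⊗ [a, b] = ᵇt ⊗ a - ᵃt ⊗ b`.
    (fun t x => (H.p x • t + H.c x • Square.act F L H.b t,
      H.q x • t - H.c x • Square.act F L H.a t))
    (fun t t' x => by ext <;> simp <;> module)
    (fun k t x => by ext <;> simp <;> module)
    (fun t x x' => by ext <;> simp <;> module)
    (fun k t x => by ext <;> simp <;> module)

theorem tripleForm_apply (t : Square F L) (x : L) : H.tripleForm t x =
    (H.p x • t + H.c x • Square.act F L H.b t,
      H.q x • t - H.c x • Square.act F L H.a t) := rfl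

theorem two_mul_finrank_square_le [Module.Finite F (Square F L)]
    [Module.Finite F (TripleTensor F L)] :
    2 * Module.finrank F (Square F L) ≤ Module.finrank F (TripleTensor F L) := by
  have hz : ∀ {i : ZMod 2} {x : L}, x ∈ (gr i : Submodule F L) → i = 0 ∨ x = 0 := by
    intro i x hx
    rcases zmod2 i with rfl | rfl
    exacts [.inl rfl, .inr (H.eq_zero_of_mem_gr_one hx)]
  have hact : (Square.actOnSquare F L).act = Square.act F L := rfl
  obtain ⟨f, hf⟩ := Tensor.exists_linearMap_of_bilinear (Square.actOnBase F L)
    (Square.actOnSquare F L) H.tripleForm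
    (by
      intro i i' j t t' x _ _ _
      simp only [H.br_square, H.actOnBase_act, map_zero, LinearMap.zero_apply, smul_zero, sub_zero])
    (by
      intro i j j' t x x' ht hx hx'
      rcases hz hx with rfl | rfl
      · rcases hz hx' with rfl | rfl
        · rw [ksgn_zero_left, ksgn_zero_right, one_smul, one_smul]
          -- The terms in `c` on the right act twice on `t` and vanish. What is left follows by
          -- expanding the actions of `x` and `x'` through those of `a` and `b`.
          simp only [tripleForm_apply, hact, H.act_act, p_br, q_br, c_br, smul_zero, add_zero,
            sub_zero, zero_smul]
          rw [H.act_eq x, H.act_eq x']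
          refine Prod.ext ?_ ?_
          · simp only [Prod.fst_sub]
            module
          · simp only [Prod.snd_sub]
            module
        · simp
      · simp)
    (by
      intro t t' x x'
      simp only [H.actOnBase_act, map_zero])
  have hs : Function.Surjective f := by
    rintro ⟨t, t'⟩
    refine ⟨Tensor.tens _ _ t H.a + Tensor.tens _ _ t' H.b, ?_⟩
    simp only [map_add, hf, tripleForm_apply, H.p_a, H.q_a, H.c_a, H.p_b, H.q_b, H.c_b]
    simp
  have := LinearMap.finrank_le_finrank_of_surjective hs
  rw [Module.finrank_prod, ← two_mul] at this
  exact this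

end HeisenbergCoordinates

end HeisenbergTensor

end SLie

/-! ### The bound and the case of equality -/

theorem mainTheorem1 {F : Type*} [Field F] (hF2 : ringChar F ≠ 2) (hF3 : ringChar F ≠ 3)
    {L : Type*} [AddCommGroup L] [Module F L] [SLie.LieSuperalgebra F L]
    (m n r s : ℕ) (hL : SLie.SDim (⊤ : Submodule F L) m n)
    (hL' : SLie.SDim (SLie.derived F L) r s)
    (hna : ¬ SLie.IsAbelian F L) (hnil : SLie.IsNilpotent F L) :
    Module.Finite F (SLie.TripleTensor F L) ∧
    (Module.finrank F (SLie.TripleTensor F L) : ℤ) ≤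
      ((m : ℤ) + n) * ((m : ℤ) + n - ((r : ℤ) + s)) ^ 2 ∧
    (r = 1 → s = 0 →
      ((Module.finrank F (SLie.TripleTensor F L) : ℤ) =
          ((m : ℤ) + n) * ((m : ℤ) + n - ((r : ℤ) + s)) ^ 2 ↔
        Nonempty (SLie.SEquiv F L (SLie.Heisenberg F 1 0)))) := by
  obtain ⟨hfin, hd⟩ := SLie.finrank_eq_of_sDim_top hL
  obtain ⟨W, hgr, hW, hWd⟩ := SLie.exists_graded_sup_derived_eq_top hL hL'
  obtain ⟨hfinS, hS⟩ := SLie.Tensor.finite_and_finrank_le (SLie.adjoint F L) (SLie.adjoint F L)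
    hnil hgr hW
  obtain ⟨hfinT, hT⟩ := SLie.Tensor.finite_and_finrank_le (SLie.Square.actOnBase F L)
    (SLie.Square.actOnSquare F L) hnil hgr hW
  -- `k` is the slack in `dim W ≤ m + n - (r + s)`; carrying it along avoids proving that it is zero
  -- and turns the integer difference into a natural number.
  obtain ⟨k, hk⟩ := Nat.exists_eq_add_of_le hWd
  have hδ : (m : ℤ) + n - ((r : ℤ) + s) = (Module.finrank F W + k : ℕ) := by
    zify at hk
    push_cast
    linarith
  rw [hd] at hS
  have hle : Module.finrank F (SLie.TripleTensor F L) ≤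
      (m + n) * Module.finrank F W * Module.finrank F W :=
    hT.trans (Nat.mul_le_mul_right _ hS)
  have hle' : (m + n) * Module.finrank F W * Module.finrank F W ≤
      (m + n) * (Module.finrank F W + k) ^ 2 := by
    rw [mul_assoc, ← sq]
    gcongr
    omega
  rw [hδ]
  refine ⟨hfinT, by exact_mod_cast hle.trans hle', ?_⟩
  rintro rfl rfl
  constructor
  · intro heq
    have heq' : Module.finrank F (SLie.TripleTensor F L) =
        (m + n) * (Module.finrank F W + k) ^ 2 := by exact_mod_cast heq
    -- If `W` were zero, the zero subalgebra would generate `L`, and `L` would be abelian.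
    have hWpos : 0 < Module.finrank F W := by
      rw [Nat.pos_iff_ne_zero]
      intro h0
      rw [Submodule.finrank_eq_zero.1 h0] at hW
      have hbot := SLie.eq_top_of_sup_derived_eq_top hnil hW (by simp)
      refine hna fun x y => ?_
      have hx : x ∈ (⊥ : Submodule F L) := hbot ▸ Submodule.mem_top
      rw [(Submodule.mem_bot F).1 hx, map_zero, LinearMap.zero_apply]
    -- Equality for the triple product passes down to the square: cancel one factor `dim W` in `(m +
    -- n) * (dim W)² ≤ dim ⊗³L ≤ dim (L ⊗ L) * dim W`.
    have hSq : Module.finrank F L * Module.finrank F W ≤ Module.finrank F (SLie.Square F L) := by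
      rw [hd]
      refine Nat.le_of_mul_le_mul_right (c := Module.finrank F W) ?_ hWpos
      exact hle'.trans (heq'.symm.le.trans hT)
    refine SLie.nonempty_sEquiv_heisenberg_of_tens_ne_zero hF2 hF3 hL' hna hnil ?_
    intro z hz hz0 x hx
    -- The part of `x` in `[L, L]` is invisible to `z ⊗ -`, so injectivity on `W` kills the other
    -- part.
    obtain ⟨w, hw, u, hu, rfl⟩ := Submodule.mem_sup.1 (hW.ge (Submodule.mem_top (x := x)))
    rw [map_add, SLie.tens_derived_derived hL' hnil hz hu, add_zero] at hx
    have := (SLie.Tensor.eq_zero_or_eq_zero_of_tens_eq_zero _ _ hnil hgr hW hSq hw hx).resolve_left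
      hz0
    rwa [this, zero_add]
  · rintro ⟨e⟩
    have h6 := e.coordinates.six_le_finrank_square
    have h12 := e.coordinates.two_mul_finrank_square_le
    have h3 : m + n = 3 := by
      rw [← hd, e.toLinearEquiv.finrank_eq]
      simp
    have hWk : Module.finrank F W + k = 2 := by omega
    rw [hWk]
    rw [h3, hWk] at hle'
    -- The general bound gives at most `3 * 2²`, the two lower bounds give at least `2 * 6`.
    have : (Module.finrank F (SLie.TripleTensor F L) : ℤ) = 12 := by
      have := hle.trans (h3 ▸ hle')
      omega
    rw [this]
    have h3' : (m : ℤ) + n = 3 := by exact_mod_cast h3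
    rw [h3']
    norm_num
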